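/- Let $p,q\in(1,\infty)$ and $p'=\frac{p}{p-1}$. For $0<s<\infty$ let $L^{s,q}(0,\infty)$ be the Lorentz space of (classes of) real-valued measurable functions $f$ on $(0,\infty)$ with $$\|f\|_{s,q}=s^{1/q}\Bigl(\int_0^\infty t^{q-1}\,\bigl|\{x\in(0,\infty):|f(x)|>t\}\bigr|^{q/s}\,dt\Bigr)^{1/q}<\infty .$$ For every $f\in L^{p,q}(0,\infty)$ and every $t>0$ the integral $$Lf(t)=\int_0^\infty f(s)e^{-ts}\,ds$$ converges absolutely, and the Laplace transform $L$ is a bounded linear operator $L^{p,q}(0,\infty)\to L^{p',q}(0,\infty)$. Moreover: 1. $L$ is not strictly singular, i.e. there is an infinite-dimensional subspace $Z\subseteq L^{p,q}(0,\infty)$ such that $L|_Z$ is an isomorphism from $Z$ onto $L(Z)$. 2. Such a $Z$ can be taken to be a span of dilates: there are $f\in L^{p,q}(0,\infty)$ and numbers $a_i>0$ $(i\in\mathbb N)$ such that, with $g_i(t)=a_i^{1/p}f(a_it)$, the space $Z=\operatorname{span}\{g_i: i\in\mathbb N\}$ is infinite-dimensional and $L|_Z$ is an isomorphism from $Z$ onto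 $L(Z)$. 3. For every integer $n\ge1$ the $n$th Bernstein number $$b_n(L)=\sup\Bigl\{\inf_{x\in X_n,\ \|x\|_{p,q}=1}\|Lx\|_{p',q}\ :\ X_n\subseteq L^{p,q}(0,\infty),\ \dim X_n=n\Bigr\}$$ equals the operator norm $\|L\|=\sup\{\|Lx\|_{p',q}:\|x\|_{p,q}\le1\}$. -/

import Mathlib

open MeasureTheory Set
open scoped ENNReal NNReal

/-- The Lorentz functional
`‖f‖_{p,q} = p^(1/q) * (∫_0^∞ t^(q-1) * μ{x : |f x| > t}^(q/p) dt)^(1/q)`, with values in `[0, ∞]`. -/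
noncomputable def lorentzENorm {Ω : Type*} [MeasurableSpace Ω] (μ : Measure Ω) (p q : ℝ)
    (f : Ω → ℝ) : ℝ≥0∞ :=
  ENNReal.ofReal p ^ (1 / q) *
    (∫⁻ t in Ioi (0 : ℝ), ENNReal.ofReal (t ^ (q - 1)) * μ {x | t < |f x|} ^ (q / p)) ^ (1 / q)

theorem lorentzENorm_lt_top_iff {Ω : Type*} [MeasurableSpace Ω] {μ : Measure Ω} {p q : ℝ}
    (hp : 0 < p) (hq : 0 < q) {f : Ω → ℝ} :
    lorentzENorm μ p q f < ∞ ↔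
      ∫⁻ t in Ioi (0 : ℝ), ENNReal.ofReal (t ^ (q - 1)) * μ {x | t < |f x|} ^ (q / p) < ∞ := by
  have hq' : 0 < 1 / q := by positivity
  have h0 : ENNReal.ofReal p ^ (1 / q) ≠ 0 := by
    simp [ENNReal.rpow_eq_zero_iff, hp]
  have h1 : ENNReal.ofReal p ^ (1 / q) ≠ ∞ :=
    ENNReal.rpow_ne_top_of_nonneg hq'.le ENNReal.ofReal_ne_top
  unfold lorentzENorm
  constructor
  · intro h
    have := ENNReal.lt_top_of_mul_ne_top_right h.ne h0
    exact (ENNReal.rpow_lt_top_iff_of_pos hq').1 this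
  · intro h
    exact ENNReal.mul_lt_top h1.lt_top ((ENNReal.rpow_lt_top_iff_of_pos hq').2 h)

theorem lorentz_scale {D : ℝ → ℝ≥0∞} {q : ℝ} {c : ℝ} (hc : 0 < c)
    (h : ∫⁻ t in Ioi (0 : ℝ), ENNReal.ofReal (t ^ (q - 1)) * D t < ∞) :
    ∫⁻ t in Ioi (0 : ℝ), ENNReal.ofReal (t ^ (q - 1)) * D (c * t) < ∞ := by
  have himg : (fun t : ℝ => c⁻¹ * t) '' Ioi 0 = Ioi 0 := by
    rw [Set.image_mul_left_Ioi (inv_pos.2 hc)]; simp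
  have key := lintegral_image_eq_lintegral_abs_deriv_mul (s := Ioi (0 : ℝ))
    (f := fun t => c⁻¹ * t) (f' := fun _ => c⁻¹) measurableSet_Ioi
    (fun x _ => by simpa using ((hasDerivAt_id x).const_mul c⁻¹).hasDerivWithinAt)
    (fun x _ y _ hxy => by simpa [hc.ne'] using hxy)
    (fun t => ENNReal.ofReal (t ^ (q - 1)) * D (c * t))
  rw [himg] at key
  rw [key]
  have : ∫⁻ x in Ioi (0 : ℝ), ENNReal.ofReal |c⁻¹| *
      (ENNReal.ofReal ((c⁻¹ * x) ^ (q - 1)) * D (c * (c⁻¹ * x))) =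
      ∫⁻ x in Ioi (0 : ℝ), (ENNReal.ofReal |c⁻¹| * ENNReal.ofReal (c⁻¹ ^ (q - 1))) *
        (ENNReal.ofReal (x ^ (q - 1)) * D x) := by
    refine setLIntegral_congr_fun measurableSet_Ioi fun x hx => ?_
    have hx0 : (0 : ℝ) < x := hx
    have e : c * (c⁻¹ * x) = x := by field_simp
    simp only [e]
    rw [Real.mul_rpow (inv_nonneg.2 hc.le) hx0.le, ENNReal.ofReal_mul (by positivity)]
    ring
  rw [this, lintegral_const_mul' _ _ (ENNReal.mul_ne_top ENNReal.ofReal_ne_top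
    ENNReal.ofReal_ne_top)]
  exact ENNReal.mul_lt_top (ENNReal.mul_lt_top ENNReal.ofReal_lt_top ENNReal.ofReal_lt_top) h

theorem lorentzENorm_add_lt_top {Ω : Type*} [MeasurableSpace Ω] {μ : Measure Ω} {p q : ℝ}
    (hp : 0 < p) (hq : 0 < q) {f g : Ω → ℝ} (hf : lorentzENorm μ p q f < ∞)
    (hg : lorentzENorm μ p q g < ∞) : lorentzENorm μ p q (f + g) < ∞ := by
  rw [lorentzENorm_lt_top_iff hp hq] at *
  have hs : 0 < q / p := by positivity
  have hf' := lorentz_scale (D := fun t => μ {x | t < |f x|} ^ (q / p)) (q := q)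
    (c := 1 / 2) (by norm_num) hf
  have hg' := lorentz_scale (D := fun t => μ {x | t < |g x|} ^ (q / p)) (q := q)
    (c := 1 / 2) (by norm_num) hg
  have hmeas : Measurable fun t : ℝ => μ {x | 1 / 2 * t < |f x|} ^ (q / p) := by
    refine Antitone.measurable fun s t hst => ?_
    refine ENNReal.rpow_le_rpow (measure_mono fun x hx => ?_) hs.le
    simp only [mem_ofPred_eq] at hx ⊢
    linarith
  have hbound : ∀ t : ℝ, μ {x | t < |(f + g) x|} ^ (q / p) ≤
      (2 : ℝ≥0∞) ^ (q / p) * (μ {x | 1 / 2 * t < |f x|} ^ (q / p) +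
        μ {x | 1 / 2 * t < |g x|} ^ (q / p)) := by
    intro t
    set A := μ {x | 1 / 2 * t < |f x|}
    set B := μ {x | 1 / 2 * t < |g x|}
    have h1 : μ {x | t < |(f + g) x|} ≤ A + B := by
      refine le_trans (measure_mono fun x hx => ?_) (measure_union_le _ _)
      simp only [mem_ofPred_eq, Pi.add_apply, mem_union] at hx ⊢
      by_contra! hcon
      have := abs_add_le (f x) (g x)
      linarith [hcon.1, hcon.2]
    have h2 : A + B ≤ 2 * max A B := by
      rw [two_mul]; exact add_le_add (le_max_left _ _) (le_max_right _ _)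
    calc _ ≤ (2 * max A B) ^ (q / p) := ENNReal.rpow_le_rpow (h1.trans h2) hs.le
      _ = 2 ^ (q / p) * (max A B) ^ (q / p) := ENNReal.mul_rpow_of_nonneg _ _ hs.le
      _ ≤ _ := by
        gcongr
        rcases le_total A B with h | h
        · rw [max_eq_right h]; exact le_add_self
        · rw [max_eq_left h]; exact le_self_add
  have hC : (2 : ℝ≥0∞) ^ (q / p) ≠ ∞ := ENNReal.rpow_ne_top_of_nonneg hs.le (by simp)
  calc ∫⁻ t in Ioi (0 : ℝ), ENNReal.ofReal (t ^ (q - 1)) * μ {x | t < |(f + g) x|} ^ (q / p)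
      ≤ ∫⁻ t in Ioi (0 : ℝ), (2 : ℝ≥0∞) ^ (q / p) *
          (ENNReal.ofReal (t ^ (q - 1)) * μ {x | 1 / 2 * t < |f x|} ^ (q / p) +
          ENNReal.ofReal (t ^ (q - 1)) * μ {x | 1 / 2 * t < |g x|} ^ (q / p)) := by
        refine lintegral_mono fun t => ?_
        refine (mul_le_mul_right (hbound t) _).trans (le_of_eq ?_)
        ring
    _ = (2 : ℝ≥0∞) ^ (q / p) *
          ((∫⁻ t in Ioi (0 : ℝ), ENNReal.ofReal (t ^ (q - 1)) *
              μ {x | 1 / 2 * t < |f x|} ^ (q / p)) +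
          ∫⁻ t in Ioi (0 : ℝ), ENNReal.ofReal (t ^ (q - 1)) *
              μ {x | 1 / 2 * t < |g x|} ^ (q / p)) := by
        rw [lintegral_const_mul' _ _ hC, lintegral_add_left]
        exact ((measurable_id.pow_const (q - 1)).ennreal_ofReal).mul hmeas
    _ < ∞ := ENNReal.mul_lt_top hC.lt_top (ENNReal.add_lt_top.2 ⟨hf', hg'⟩)

theorem lorentzENorm_zero_lt_top {Ω : Type*} [MeasurableSpace Ω] {μ : Measure Ω} {p q : ℝ}
    (hp : 0 < p) (hq : 0 < q) : lorentzENorm μ p q (0 : Ω → ℝ) < ∞ := by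
  rw [lorentzENorm_lt_top_iff hp hq]
  have hs : 0 < q / p := by positivity
  rw [setLIntegral_congr_fun (g := fun _ => 0) measurableSet_Ioi]
  · simp
  · intro t ht
    have : {x : Ω | t < |(0 : Ω → ℝ) x|} = ∅ := by
      ext x; simpa using (le_of_lt (show (0 : ℝ) < t from ht))
    simp only [this, measure_empty, ENNReal.zero_rpow_of_pos hs, mul_zero]

theorem lorentzENorm_smul_lt_top {Ω : Type*} [MeasurableSpace Ω] {μ : Measure Ω} {p q : ℝ}
    (hp : 0 < p) (hq : 0 < q) (c : ℝ) {f : Ω → ℝ} (hf : lorentzENorm μ p q f < ∞) :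
    lorentzENorm μ p q (c • f) < ∞ := by
  rcases eq_or_ne c 0 with rfl | hc
  · rw [zero_smul]; exact lorentzENorm_zero_lt_top hp hq
  rw [lorentzENorm_lt_top_iff hp hq] at *
  have hc' : 0 < |c| := abs_pos.2 hc
  have := lorentz_scale (D := fun t => μ {x | t < |f x|} ^ (q / p)) (q := q)
    (c := |c|⁻¹) (inv_pos.2 hc') hf
  convert this using 8 with t x
  simp only [Pi.smul_apply, smul_eq_mul, abs_mul]
  rw [inv_mul_lt_iff₀ hc']

theorem lorentzENorm_congr {Ω : Type*} [MeasurableSpace Ω] {μ : Measure Ω} {p q : ℝ}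
    {f g : Ω → ℝ} (h : f =ᵐ[μ] g) : lorentzENorm μ p q f = lorentzENorm μ p q g := by
  have : ∀ t : ℝ, μ {x | t < |f x|} = μ {x | t < |g x|} := fun t => by
    refine measure_congr ?_
    filter_upwards [h] with x hx
    exact propext (by change t < |f x| ↔ t < |g x|; rw [hx])
  simp only [lorentzENorm, this]

/-- The Lorentz space `L^{p,q}(μ)` of real-valued measurable functions modulo equality a.e. -/
noncomputable def lorentzSpace {Ω : Type*} [MeasurableSpace Ω] (μ : Measure Ω) (p q : ℝ)
    (hp : 0 < p) (hq : 0 < q) : Submodule ℝ (Ω →ₘ[μ] ℝ) where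
  carrier := {f | lorentzENorm μ p q f < ∞}
  zero_mem' := by
    change lorentzENorm μ p q _ < ∞
    rw [lorentzENorm_congr AEEqFun.coeFn_zero]
    exact lorentzENorm_zero_lt_top hp hq
  add_mem' := by
    intro f g hf hg
    change lorentzENorm μ p q _ < ∞
    rw [lorentzENorm_congr (AEEqFun.coeFn_add f g)]
    exact lorentzENorm_add_lt_top hp hq hf hg
  smul_mem' := by
    intro c f hf
    change lorentzENorm μ p q _ < ∞
    rw [lorentzENorm_congr (AEEqFun.coeFn_smul c f)]
    exact lorentzENorm_smul_lt_top hp hq c hf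

/-- The quasi-norm of `L^{p,q}(μ)`; it is finite on this space. -/
noncomputable instance lorentzSpace.instENorm {Ω : Type*} [MeasurableSpace Ω] (μ : Measure Ω)
    (p q : ℝ) (hp : 0 < p) (hq : 0 < q) : ENorm (lorentzSpace μ p q hp hq) where
  enorm f := lorentzENorm μ p q (f : Ω →ₘ[μ] ℝ)

/-- Lebesgue measure on `(0, ∞)`. -/
noncomputable abbrev halfLine : Measure ℝ := volume.restrict (Ioi (0 : ℝ))

/-- The Laplace transform `Lf(t) = ∫_0^∞ f(s) e^{-ts} ds`. -/
noncomputable def laplaceTransform (f : ℝ → ℝ) (t : ℝ) : ℝ :=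
  ∫ s in Ioi (0 : ℝ), f s * Real.exp (-(t * s))

section LinearMaps

variable {X Y : Type*} [AddCommGroup X] [Module ℝ X] [ENorm X]
  [AddCommGroup Y] [Module ℝ Y] [ENorm Y]

/-- The operator norm of a linear map between quasi-normed spaces, with values in `[0, ∞]`;
the map is bounded when this is finite. -/
noncomputable def opENorm (T : X →ₗ[ℝ] Y) : ℝ≥0∞ :=
  ⨆ (x : X) (_ : ‖x‖ₑ ≤ 1), ‖T x‖ₑ

/-- The `n`-th Bernstein number of `T`, for `n ≥ 1`. -/
noncomputable def bernsteinNumber (n : ℕ) (T : X →ₗ[ℝ] Y) : ℝ≥0∞ :=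
  ⨆ (Z : Submodule ℝ X) (_ : Module.rank ℝ Z = n), ⨅ (x : X) (_ : x ∈ Z ∧ ‖x‖ₑ = 1), ‖T x‖ₑ

/-- The restriction of `T` to `Z` is an isomorphism of quasi-normed spaces from `Z` onto `T(Z)`. -/
def IsIsomorphismOn (T : X →ₗ[ℝ] Y) (Z : Submodule ℝ X) : Prop :=
  ∃ c C : ℝ≥0, 0 < c ∧ ∀ x ∈ Z, c * ‖x‖ₑ ≤ ‖T x‖ₑ ∧ ‖T x‖ₑ ≤ C * ‖x‖ₑ

/-- `T` is strictly singular: it is an isomorphism on no infinite-dimensional subspace. -/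
def IsStrictlySingular (T : X →ₗ[ℝ] Y) : Prop :=
  ¬ ∃ Z : Submodule ℝ X, ¬ FiniteDimensional ℝ Z ∧ IsIsomorphismOn T Z

end LinearMaps

theorem exponent_pos {p : ℝ} (hp : 1 < p) : 0 < p := zero_lt_one.trans hp

theorem conjExponent_pos {p : ℝ} (hp : 1 < p) : 0 < p / (p - 1) :=
  div_pos (zero_lt_one.trans hp) (sub_pos.2 hp)

/-! ### Layer cake formulas and the decreasing rearrangement -/

/-! Put `r = p / (p - 1)`. The norm of the Laplace transform `L` is exactly `Γ(1/r)`, and it is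
almost attained on infinite-dimensional spans of dilates: for each `β < Γ(1/r)` there is such a span
on which `‖L x‖ ≥ β ‖x‖`. All three claims follow from these two facts.

Upper bound. On decreasing functions the Lorentz norm is an `L^q` norm with a power weight
(`weightedPow`). The kernel `e^{-ts}` decreases in `s`, so the Hardy–Littlewood inequality
`lintegral_abs_mul_le_rearrangement` gives `|Lf| ≤ L(f*)`, and `L(f*)` is again decreasing. What
remains is a weighted `L^q` estimate, proved by a Schur test with the power `s^(-1/p)`
(`weightedPow_lintegralLaplace_le`). The constant is `Γ(1/r)` because `L` sends `s^(-1/p)` to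
`Γ(1/r) t^(-1/r)`.

Lower bound. The power `s^(-1/p)` is a formal extremal outside the space, so it is damped by
`min(as, 1/(as))^η` with small `η`. If the numbers `log a_i` are very far apart, the damped powers
are almost disjoint on the logarithmic scale, and the norm of a combination is at most nearly a
multiple of the `ℓ^q` norm of its coefficients (`exists_weightedPow_sum_le`). To bound `L x` below,
it is paired with a decreasing combination `Q` of damped powers whose coefficients come from the
`ℓ^q` norming functional. Interactions between different dilates are never estimated: by
`two_mul_sum_le_of_aligned`, twice the diagonal of the pairing is at most `∫ |Lx| Q + ∫ L(P) Q`,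
where `P` is `x` with absolute values on its coefficients. The upper bound controls the last
integral by `Γ(1/r)` times the bounds for the norms of `P` and `Q`, and the diagonal is almost as
large as that product; hence `∫ |Lx| Q` is almost as large too. -/

theorem lintegral_rpow_mul_ite_lt {r : ℝ} (hr : 0 < r) (a : ℝ≥0∞) :
    ∫⁻ t in Ioi (0 : ℝ), ENNReal.ofReal (t ^ (r - 1)) * (if ENNReal.ofReal t < a then 1 else 0) =
      ENNReal.ofReal r⁻¹ * a ^ r := by
  have hnn : ∀ᵐ t ∂(volume.restrict (Ioi (0 : ℝ))), 0 ≤ t ^ (r - 1) :=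
    (ae_restrict_mem measurableSet_Ioi).mono fun t ht => Real.rpow_nonneg (le_of_lt ht) _
  rcases eq_or_ne a ∞ with rfl | ha
  · have h1 : ∫⁻ t in Ioi (0 : ℝ), ENNReal.ofReal (t ^ (r - 1)) = ∞ := by
      by_contra h
      refine not_integrableOn_Ioi_rpow (r - 1) ⟨?_, ?_⟩
      · exact (measurable_id.pow_const _).aestronglyMeasurable
      · rw [hasFiniteIntegral_iff_ofReal hnn]
        exact lt_top_iff_ne_top.2 h
    simp [ENNReal.top_rpow_of_pos hr, h1, ENNReal.mul_top, hr]
  · lift a to ℝ≥0 using ha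
    have h1 : ∫⁻ t in Ioi (0 : ℝ), ENNReal.ofReal (t ^ (r - 1)) *
        (if ENNReal.ofReal t < (a : ℝ≥0∞) then 1 else 0) =
        ∫⁻ t in Ioo (0 : ℝ) a, ENNReal.ofReal (t ^ (r - 1)) := by
      rw [← lintegral_indicator measurableSet_Ioi, ← lintegral_indicator measurableSet_Ioo]
      refine lintegral_congr fun t => ?_
      by_cases h0 : 0 < t
      · have : ENNReal.ofReal t < (a : ℝ≥0∞) ↔ t < a := by
          rw [← ENNReal.ofReal_coe_nnreal, ENNReal.ofReal_lt_ofReal_iff_of_nonneg h0.le]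
        by_cases hta : t < a
        · simp [indicator, h0, this, hta]
        · simp [indicator, h0, this, hta]
      · simp [indicator, h0]
    have hi : IntegrableOn (fun t : ℝ => t ^ (r - 1)) (Ioc 0 a) := by
      have := (intervalIntegral.intervalIntegrable_rpow' (a := 0) (b := (a : ℝ))
        (show -1 < r - 1 by linarith))
      rwa [intervalIntegrable_iff_integrableOn_Ioc_of_le a.coe_nonneg] at this
    rw [h1, Measure.restrict_congr_set Ioo_ae_eq_Ioc, ← ofReal_integral_eq_lintegral_ofReal hi
      ((ae_restrict_mem measurableSet_Ioc).mono fun t ht => Real.rpow_nonneg (le_of_lt ht.1) _),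
      ← intervalIntegral.integral_of_le a.coe_nonneg, integral_rpow (Or.inl (by linarith)),
      ← ENNReal.ofReal_coe_nnreal, ENNReal.ofReal_rpow_of_nonneg a.coe_nonneg hr.le,
      ← ENNReal.ofReal_mul (by positivity)]
    congr 1
    simp [Real.zero_rpow hr.ne']
    field_simp

theorem lintegral_ite_lt (a : ℝ≥0∞) :
    ∫⁻ t in Ioi (0 : ℝ), (if ENNReal.ofReal t < a then 1 else 0) = a := by
  simpa using lintegral_rpow_mul_ite_lt one_pos a

/-- The generalized inverse of a decreasing function on `(0, ∞)`. -/
noncomputable def decreasingInverse (E : ℝ → ℝ≥0∞) (t : ℝ) : ℝ≥0∞ :=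
  ∫⁻ s in Ioi (0 : ℝ), if ENNReal.ofReal t < E s then 1 else 0

theorem decreasingInverse_antitone (E : ℝ → ℝ≥0∞) : Antitone (decreasingInverse E) := by
  intro s t hst
  refine lintegral_mono fun x => ?_
  have := ENNReal.ofReal_le_ofReal hst
  dsimp only
  split_ifs with h1 h2 h2
  · exact le_rfl
  · exact absurd (this.trans_lt h1) h2
  · exact zero_le
  · exact le_rfl

theorem lt_of_lt_decreasingInverse {E : ℝ → ℝ≥0∞} (hE : AntitoneOn E (Ioi 0)) {s t : ℝ}
    (hs : 0 < s) (h : ENNReal.ofReal s < decreasingInverse E t) : ENNReal.ofReal t < E s := by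
  by_contra! hcon
  refine h.not_ge ?_
  calc decreasingInverse E t
      ≤ ∫⁻ x in Ioi (0 : ℝ), if ENNReal.ofReal x < ENNReal.ofReal s then 1 else 0 := by
        refine setLIntegral_mono' measurableSet_Ioi fun x hx => ?_
        have hx' : (0 : ℝ) < x := hx
        split_ifs with h1 h2 h2
        · exact le_rfl
        · rw [ENNReal.ofReal_lt_ofReal_iff hs, not_lt] at h2
          exact absurd h1 ((hE hs hx h2).trans hcon).not_gt
        · exact zero_le
        · exact le_rfl
    _ = ENNReal.ofReal s := lintegral_ite_lt _

/-- By the layer cake formula both sides integrate `a t^(a-1) * b s^(b-1)` over a region in the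
quadrant: `s < decreasingInverse E t` on the left, `t < E s` on the right. The first region lies in
the second, and Tonelli exchanges the variables. The lemma is used in both directions between
distribution functions and decreasing functions. -/
theorem lintegral_decreasingInverse_rpow_le {E : ℝ → ℝ≥0∞} (hE : AntitoneOn E (Ioi 0))
    (hEm : Measurable E) {a b : ℝ} (ha : 0 < a) (hb : 0 < b) :
    ENNReal.ofReal a * ∫⁻ t in Ioi (0 : ℝ), ENNReal.ofReal (t ^ (a - 1)) *
        decreasingInverse E t ^ b ≤
      ENNReal.ofReal b * ∫⁻ s in Ioi (0 : ℝ), ENNReal.ofReal (s ^ (b - 1)) * E s ^ a := by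
  have key : ∀ {c : ℝ}, 0 < c → ∀ x : ℝ≥0∞, x ^ c = ENNReal.ofReal c *
      ∫⁻ t in Ioi (0 : ℝ), ENNReal.ofReal (t ^ (c - 1)) *
        (if ENNReal.ofReal t < x then 1 else 0) := by
    intro c hc x
    rw [lintegral_rpow_mul_ite_lt hc, ← mul_assoc, ← ENNReal.ofReal_mul hc.le,
      mul_inv_cancel₀ hc.ne']
    simp
  have hm : ∀ c : ℝ, Measurable fun t : ℝ => ENNReal.ofReal (t ^ c) := fun c =>
    (measurable_id.pow_const _).ennreal_ofReal
  have hite : Measurable fun z : ℝ × ℝ => if ENNReal.ofReal z.1 < E z.2 then (1 : ℝ≥0∞) else 0 :=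
    Measurable.ite (measurableSet_lt (by fun_prop) (by fun_prop)) measurable_const
      measurable_const
  calc ENNReal.ofReal a * ∫⁻ t in Ioi (0 : ℝ), ENNReal.ofReal (t ^ (a - 1)) *
        decreasingInverse E t ^ b
      ≤ ENNReal.ofReal a * ∫⁻ t in Ioi (0 : ℝ), ENNReal.ofReal b *
          ∫⁻ s in Ioi (0 : ℝ), ENNReal.ofReal (t ^ (a - 1)) * (ENNReal.ofReal (s ^ (b - 1)) *
            (if ENNReal.ofReal t < E s then 1 else 0)) := by
        refine mul_le_mul_right (setLIntegral_mono' measurableSet_Ioi fun t _ => ?_) _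
        rw [key hb, lintegral_const_mul' _ _ ENNReal.ofReal_ne_top, mul_left_comm]
        refine mul_le_mul_right (mul_le_mul_right ?_ _) _
        refine setLIntegral_mono' measurableSet_Ioi fun s hs => mul_le_mul_right ?_ _
        split_ifs with h1 h2 h2
        · exact le_rfl
        · exact absurd (lt_of_lt_decreasingInverse hE hs h1) h2
        · exact zero_le
        · exact le_rfl
    _ = ENNReal.ofReal b * ∫⁻ s in Ioi (0 : ℝ), ENNReal.ofReal a *
          ∫⁻ t in Ioi (0 : ℝ), ENNReal.ofReal (t ^ (a - 1)) * (ENNReal.ofReal (s ^ (b - 1)) *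
            (if ENNReal.ofReal t < E s then 1 else 0)) := by
        rw [lintegral_const_mul' _ _ ENNReal.ofReal_ne_top,
          lintegral_const_mul' _ _ ENNReal.ofReal_ne_top, lintegral_lintegral_swap]
        · ring
        · exact (((hm _).comp measurable_fst).mul
            (((hm _).comp measurable_snd).mul hite)).aemeasurable
    _ = _ := by
        congr 1
        refine lintegral_congr fun s => ?_
        simp_rw [mul_left_comm (ENNReal.ofReal (_ ^ (a - 1))) (ENNReal.ofReal (s ^ (b - 1)))]
        rw [lintegral_const_mul' _ _ ENNReal.ofReal_ne_top, mul_left_comm, ← key ha]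

/-- The distribution function of `f` on `(0, ∞)`. -/
noncomputable def distribution (f : ℝ → ℝ) (t : ℝ) : ℝ≥0∞ := halfLine {x | t < |f x|}

theorem distribution_antitone (f : ℝ → ℝ) : Antitone (distribution f) := fun _ _ hst =>
  measure_mono fun _ hx => lt_of_le_of_lt hst hx

/-- The decreasing rearrangement of `f`. -/
noncomputable def rearrangement (f : ℝ → ℝ) : ℝ → ℝ≥0∞ := decreasingInverse (distribution f)

theorem rearrangement_antitone (f : ℝ → ℝ) : Antitone (rearrangement f) :=
  decreasingInverse_antitone _

/-- The `q`-th power of the weighted Lebesgue norm which agrees with the Lorentz norm on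
decreasing functions. -/
noncomputable def weightedPow (p q : ℝ) (φ : ℝ → ℝ≥0∞) : ℝ≥0∞ :=
  ∫⁻ s in Ioi (0 : ℝ), ENNReal.ofReal (s ^ (q / p - 1)) * φ s ^ q

theorem lorentzENorm_rpow {p q : ℝ} (hq : 0 < q) (f : ℝ → ℝ) :
    lorentzENorm halfLine p q f ^ q = ENNReal.ofReal p *
      ∫⁻ t in Ioi (0 : ℝ), ENNReal.ofReal (t ^ (q - 1)) * distribution f t ^ (q / p) := by
  rw [lorentzENorm, ENNReal.mul_rpow_of_nonneg _ _ hq.le, ← ENNReal.rpow_mul,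
    ← ENNReal.rpow_mul, one_div, inv_mul_cancel₀ hq.ne']
  simp [distribution]

theorem ofReal_div_mul_eq {p : ℝ} (hp : 0 < p) (q : ℝ) (x : ℝ≥0∞) :
    ENNReal.ofReal p * (ENNReal.ofReal (q / p) * x) = ENNReal.ofReal q * x := by
  rw [← mul_assoc, ← ENNReal.ofReal_mul hp.le, mul_div_cancel₀ _ hp.ne']

theorem ofReal_mul_le_cancel {q : ℝ} (hq : 0 < q) {x y : ℝ≥0∞}
    (h : ENNReal.ofReal q * x ≤ ENNReal.ofReal q * y) : x ≤ y :=
  (ENNReal.mul_le_mul_iff_right (by simpa using hq) ENNReal.ofReal_ne_top).1 h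

theorem weightedPow_rearrangement_le {p q : ℝ} (hp : 0 < p) (hq : 0 < q) (f : ℝ → ℝ) :
    weightedPow p q (rearrangement f) ≤ lorentzENorm halfLine p q f ^ q := by
  have h := lintegral_decreasingInverse_rpow_le ((distribution_antitone f).antitoneOn _)
    (distribution_antitone f).measurable (div_pos hq hp) hq
  rw [lorentzENorm_rpow hq]
  refine ofReal_mul_le_cancel (div_pos hq hp) (h.trans_eq ?_)
  rw [mul_left_comm, ofReal_div_mul_eq hp q]

/-- Monotonicity of the majorant is essential: for `q > p` the weight `s^(q/p-1)` increases, and the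
weighted norm of a non-monotone function may be smaller than its Lorentz norm. The inverse of `φ` is
its own distribution function, so it dominates that of `f`. -/
theorem lorentzENorm_rpow_le_weightedPow {p q : ℝ} (hp : 0 < p) (hq : 0 < q) {f : ℝ → ℝ}
    {φ : ℝ → ℝ≥0∞} (hφ : AntitoneOn φ (Ioi 0)) (hφm : Measurable φ)
    (hf : ∀ᵐ x ∂halfLine, ENNReal.ofReal |f x| ≤ φ x) :
    lorentzENorm halfLine p q f ^ q ≤ weightedPow p q φ := by
  have h := lintegral_decreasingInverse_rpow_le hφ hφm hq (div_pos hq hp)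
  rw [lorentzENorm_rpow hq]
  refine ofReal_mul_le_cancel (div_pos hq hp) ?_
  rw [mul_left_comm, ofReal_div_mul_eq hp q]
  refine le_trans (mul_le_mul_right (setLIntegral_mono' measurableSet_Ioi fun t ht => ?_) _) h
  refine mul_le_mul_right (ENNReal.rpow_le_rpow ?_ (div_pos hq hp).le) _
  have hms : MeasurableSet {x | ENNReal.ofReal t < φ x} :=
    measurableSet_lt measurable_const hφm
  calc distribution f t ≤ halfLine {x | ENNReal.ofReal t < φ x} := by
        refine measure_mono_ae ?_
        filter_upwards [hf] with x hx hx1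
        have hx2 : t < |f x| := hx1
        have h0 : (0 : ℝ) < t := ht
        exact ((ENNReal.ofReal_lt_ofReal_iff (h0.trans hx2)).2 hx2).trans_le hx
    _ = decreasingInverse φ t := by
        rw [decreasingInverse, ← lintegral_indicator_one hms]
        refine lintegral_congr fun x => ?_
        simp [indicator]

/-- The Hardy–Littlewood inequality. The layer cake formula in `f` replaces it by a superlevel set
`A` and the initial interval `I` of equal measure, and a decreasing `Q` has the larger integral over
`I`. -/
theorem lintegral_abs_mul_le_rearrangement {f : ℝ → ℝ} (hf : AEMeasurable f halfLine)
    {Q : ℝ → ℝ≥0∞} (hQ : AntitoneOn Q (Ioi 0)) (hQm : Measurable Q) :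
    ∫⁻ x in Ioi (0 : ℝ), ENNReal.ofReal |f x| * Q x ≤
      ∫⁻ x in Ioi (0 : ℝ), rearrangement f x * Q x := by
  wlog hfm : Measurable f generalizing f with H
  · have h := H (f := hf.mk f) hf.measurable_mk.aemeasurable hf.measurable_mk
    have e : rearrangement (hf.mk f) = rearrangement f := by
      have : distribution (hf.mk f) = distribution f := by
        ext t
        refine measure_congr ?_
        filter_upwards [hf.ae_eq_mk] with x hx
        exact propext (by change t < |hf.mk f x| ↔ t < |f x|; rw [hx])
      rw [rearrangement, this, rearrangement]
    rw [e] at h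
    refine (lintegral_congr_ae ?_).trans_le h
    filter_upwards [hf.ae_eq_mk] with x hx
    rw [hx]
  have hDm := (distribution_antitone f).measurable
  have m1 : Measurable fun z : ℝ × ℝ =>
      if ENNReal.ofReal z.2 < ENNReal.ofReal |f z.1| then (1 : ℝ≥0∞) else 0 :=
    Measurable.ite (measurableSet_lt (by fun_prop)
      (((measurable_norm.comp hfm).ennreal_ofReal).comp measurable_fst)) measurable_const
      measurable_const
  have m2 : Measurable fun z : ℝ × ℝ =>
      if ENNReal.ofReal z.1 < distribution f z.2 then (1 : ℝ≥0∞) else 0 :=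
    Measurable.ite (measurableSet_lt (by fun_prop) (by fun_prop)) measurable_const
      measurable_const
  have e1 : ∫⁻ x in Ioi (0 : ℝ), ENNReal.ofReal |f x| * Q x = ∫⁻ t in Ioi (0 : ℝ),
      ∫⁻ x in Ioi (0 : ℝ), (if ENNReal.ofReal t < ENNReal.ofReal |f x| then 1 else 0) * Q x := by
    rw [lintegral_lintegral_swap]
    · refine lintegral_congr fun x => ?_
      rw [lintegral_mul_const _ (by exact m1.comp (measurable_const.prodMk measurable_id)),
        lintegral_ite_lt]
    · exact ((m1.comp measurable_swap).mul (hQm.comp measurable_snd)).aemeasurable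
  have e2 : ∫⁻ x in Ioi (0 : ℝ), rearrangement f x * Q x = ∫⁻ t in Ioi (0 : ℝ),
      ∫⁻ x in Ioi (0 : ℝ), (if ENNReal.ofReal x < distribution f t then 1 else 0) * Q x := by
    rw [lintegral_lintegral_swap]
    · refine lintegral_congr fun x => ?_
      rw [lintegral_mul_const _ (by exact m2.comp (measurable_const.prodMk measurable_id))]
      rfl
    · exact ((m2.comp measurable_swap).mul (hQm.comp measurable_snd)).aemeasurable
  rw [e1, e2]
  refine setLIntegral_mono' measurableSet_Ioi fun t ht => ?_
  have ht0 : (0 : ℝ) < t := ht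
  set A : Set ℝ := {x | ENNReal.ofReal t < ENNReal.ofReal |f x|} with hA
  set I : Set ℝ := {x | ENNReal.ofReal x < distribution f t} with hI
  have hAm : MeasurableSet A :=
    measurableSet_lt measurable_const ((measurable_norm.comp hfm).ennreal_ofReal)
  have hIm : MeasurableSet I := measurableSet_lt (by fun_prop) measurable_const
  have hAD : halfLine A = distribution f t := by
    rw [distribution]
    congr 1
    ext x
    exact ENNReal.ofReal_lt_ofReal_iff_of_nonneg ht0.le
  have hID : halfLine I = distribution f t := by
    rw [← lintegral_indicator_one hIm]
    refine Eq.trans (lintegral_congr fun x => ?_) (lintegral_ite_lt (distribution f t))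
    simp [indicator, hI]
  have r1 : ∀ x, (if ENNReal.ofReal t < ENNReal.ofReal |f x| then 1 else 0) * Q x =
      A.indicator Q x := fun x => by simp [indicator, hA]
  have r2 : ∀ x, (if ENNReal.ofReal x < distribution f t then 1 else 0) * Q x =
      I.indicator Q x := fun x => by simp [indicator, hI]
  simp_rw [r1, r2]
  rw [lintegral_indicator hAm, lintegral_indicator hIm]
  rcases eq_or_ne (distribution f t) ∞ with hD | hD
  · have : I = univ := by ext x; simp [hI, hD]
    rw [this, Measure.restrict_univ]
    exact setLIntegral_le_lintegral _ _
  rcases eq_or_ne (distribution f t) 0 with hD0 | hD0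
  · rw [Measure.restrict_eq_zero.2 (hAD.trans hD0)]
    simp
  set d := (distribution f t).toReal with hd
  have hdD : ENNReal.ofReal d = distribution f t := ENNReal.ofReal_toReal hD
  have hd0 : 0 < d := ENNReal.toReal_pos hD0 hD
  -- Remove the common part `A ∩ I`. The remainders have equal measure and are separated by the
  -- endpoint `d` of `I`: `Q ≤ Q d` on `A \ I` and `Q ≥ Q d` on `I \ A`.
  rw [← lintegral_inter_add_sdiff Q A hIm, ← lintegral_inter_add_sdiff Q I hAm, inter_comm I A]
  refine add_le_add le_rfl ?_
  have hmeas : halfLine (A \ I) = halfLine (I \ A) := by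
    have h1 := measure_inter_add_sdiff (μ := halfLine) A hIm
    have h2 := measure_inter_add_sdiff (μ := halfLine) I hAm
    rw [inter_comm, hID, ← hAD] at h2
    have hfin : halfLine (A ∩ I) ≠ ∞ := by
      refine ne_top_of_le_ne_top (hAD ▸ hD) (measure_mono inter_subset_left)
    exact (ENNReal.add_right_inj hfin).1 (h1.trans h2.symm)
  calc ∫⁻ x in A \ I, Q x ∂halfLine ≤ ∫⁻ x in A \ I, Q d ∂halfLine := by
        refine lintegral_mono_ae ?_
        have : ∀ᵐ x ∂halfLine.restrict (A \ I), 0 < x :=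
          ae_restrict_of_ae (ae_restrict_mem measurableSet_Ioi)
        filter_upwards [this, ae_restrict_mem (hAm.diff hIm)] with x hx0 hx
        refine hQ hd0 hx0 ?_
        have := hx.2
        rw [hI, mem_ofPred_eq, not_lt, ← hdD] at this
        exact (ENNReal.ofReal_le_ofReal_iff hx0.le).1 this
    _ = ∫⁻ x in I \ A, Q d ∂halfLine := by simp only [setLIntegral_const, hmeas]
    _ ≤ ∫⁻ x in I \ A, Q x ∂halfLine := by
        refine lintegral_mono_ae ?_
        have : ∀ᵐ x ∂halfLine.restrict (I \ A), 0 < x :=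
          ae_restrict_of_ae (ae_restrict_mem measurableSet_Ioi)
        filter_upwards [this, ae_restrict_mem (hIm.diff hAm)] with x hx0 hx
        refine hQ hx0 hd0 ?_
        have := hx.1
        rw [hI, mem_ofPred_eq, ← hdD] at this
        exact ((ENNReal.ofReal_lt_ofReal_iff hd0).1 this).le

/-! ### The Laplace transform of nonnegative functions -/

/-- The Laplace transform of a function with values in `[0, ∞]`. -/
noncomputable def lintegralLaplace (φ : ℝ → ℝ≥0∞) (t : ℝ) : ℝ≥0∞ :=
  ∫⁻ s in Ioi (0 : ℝ), φ s * ENNReal.ofReal (Real.exp (-(t * s)))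

theorem lintegral_rpow_mul_exp_neg {a t : ℝ} (ha : 0 < a) (ht : 0 < t) :
    ∫⁻ s in Ioi (0 : ℝ), ENNReal.ofReal (s ^ (a - 1)) * ENNReal.ofReal (Real.exp (-(t * s))) =
      ENNReal.ofReal (t ^ (-a) * Real.Gamma a) := by
  have h := Real.integral_rpow_mul_exp_neg_mul_Ioi ha ht
  have hpos : 0 < (1 / t) ^ a * Real.Gamma a := by
    have := Real.Gamma_pos_of_pos ha
    positivity
  have hint : IntegrableOn (fun s : ℝ => s ^ (a - 1) * Real.exp (-(t * s))) (Ioi 0) := by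
    by_contra hcon
    rw [integral_undef hcon] at h
    exact hpos.ne h
  rw [Real.rpow_neg ht.le, ← Real.inv_rpow ht.le, ← one_div, ← h,
    ofReal_integral_eq_lintegral_ofReal hint]
  · refine setLIntegral_congr_fun measurableSet_Ioi fun s hs => ?_
    have hs0 : (0 : ℝ) < s := hs
    exact (ENNReal.ofReal_mul (by positivity)).symm
  · refine (ae_restrict_mem measurableSet_Ioi).mono fun s hs => ?_
    have hs0 : (0 : ℝ) < s := hs
    simp only [Pi.zero_apply]
    positivity

theorem measurable_exp_kernel :
    Measurable fun z : ℝ × ℝ => ENNReal.ofReal (Real.exp (-(z.1 * z.2))) := by fun_prop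

theorem measurable_lintegralLaplace {φ : ℝ → ℝ≥0∞} (hφ : Measurable φ) :
    Measurable (lintegralLaplace φ) :=
  Measurable.lintegral_prod_right' (f := fun z : ℝ × ℝ => φ z.2 *
    ENNReal.ofReal (Real.exp (-(z.1 * z.2)))) ((hφ.comp measurable_snd).mul measurable_exp_kernel)

theorem lintegralLaplace_antitone (φ : ℝ → ℝ≥0∞) : Antitone (lintegralLaplace φ) := by
  intro t u htu
  refine setLIntegral_mono' measurableSet_Ioi fun s hs => ?_
  have hs0 : (0 : ℝ) < s := hs
  gcongr

theorem ofReal_rpow_mul_ofReal_rpow {s : ℝ} (hs : 0 < s) (a b : ℝ) :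
    ENNReal.ofReal (s ^ a) * ENNReal.ofReal (s ^ b) = ENNReal.ofReal (s ^ (a + b)) := by
  rw [← ENNReal.ofReal_mul (by positivity), Real.rpow_add hs]

theorem ofReal_rpow_rpow {s : ℝ} (hs : 0 < s) (a : ℝ) {b : ℝ} (hb : 0 ≤ b) :
    ENNReal.ofReal (s ^ a) ^ b = ENNReal.ofReal (s ^ (a * b)) := by
  rw [ENNReal.ofReal_rpow_of_nonneg (by positivity) hb, Real.rpow_mul hs.le]

/-- The pointwise half of the Schur test: Hölder's inequality for the measure `e^{-ts} ds`, after
inserting a power of `s` and its inverse. -/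
theorem lintegralLaplace_rpow_le {p r q : ℝ} (hpr : p.HolderConjugate r) (hq : 1 < q)
    {φ : ℝ → ℝ≥0∞} (hφ : Measurable φ) {t : ℝ} (ht : 0 < t) :
    lintegralLaplace φ t ^ q ≤ ENNReal.ofReal (t ^ (-r⁻¹) * Real.Gamma r⁻¹) ^ (q - 1) *
      ∫⁻ s in Ioi (0 : ℝ), φ s ^ q * (ENNReal.ofReal (s ^ ((q - 1) / p)) *
        ENNReal.ofReal (Real.exp (-(t * s)))) := by
  have hc : q.HolderConjugate (q / (q - 1)) := Real.HolderConjugate.conjExponent hq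
  have hq0 : 0 < q := hc.pos
  have hq1 : 0 < q - 1 := by linarith
  have hp0 := hpr.pos
  have hr0 := hpr.symm.pos
  set q' := q / (q - 1) with hq'
  have hq'0 : 0 < q' := hc.symm.pos
  have hsum : 1 / q + 1 / q' = 1 := by
    rw [one_div, one_div]; exact hc.inv_add_inv_eq_one
  set e : ℝ → ℝ≥0∞ := fun s => ENNReal.ofReal (Real.exp (-(t * s))) with he
  have hem : Measurable e := by fun_prop
  have he0 : ∀ s, e s ≠ 0 := fun s => by simp [he, Real.exp_pos]
  have heT : ∀ s, e s ≠ ∞ := fun s => ENNReal.ofReal_ne_top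
  -- Chosen so that `α * q' = 1/p`: the second Hölder factor becomes `∫ s^(-1/p) e^{-ts} ds = Γ(1/r)
  -- t^(-1/r)`.
  set α := (q - 1) / (p * q) with hα
  have hm : ∀ c : ℝ, Measurable fun t : ℝ => ENNReal.ofReal (t ^ c) := fun c =>
    (measurable_id.pow_const _).ennreal_ofReal
  have h1 : lintegralLaplace φ t = ∫⁻ s in Ioi (0 : ℝ),
      ((fun s => φ s * (ENNReal.ofReal (s ^ α) * e s ^ (1 / q))) *
        fun s => ENNReal.ofReal (s ^ (-α)) * e s ^ (1 / q')) s := by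
    refine setLIntegral_congr_fun measurableSet_Ioi fun s hs => ?_
    have hs0 : (0 : ℝ) < s := hs
    simp only [Pi.mul_apply]
    have : e s = e s ^ (1 / q) * e s ^ (1 / q') := by
      rw [← ENNReal.rpow_add _ _ (he0 s) (heT s), hsum, ENNReal.rpow_one]
    have h2 := ofReal_rpow_mul_ofReal_rpow hs0 α (-α)
    rw [add_neg_cancel, Real.rpow_zero, ENNReal.ofReal_one] at h2
    calc φ s * e s = φ s * (1 * (e s ^ (1 / q) * e s ^ (1 / q'))) := by rw [← this, one_mul]
      _ = _ := by rw [← h2]; ring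
  have h3 := ENNReal.lintegral_mul_le_Lp_mul_Lq (volume.restrict (Ioi (0 : ℝ))) hc
    (f := fun s => φ s * (ENNReal.ofReal (s ^ α) * e s ^ (1 / q)))
    (g := fun s => ENNReal.ofReal (s ^ (-α)) * e s ^ (1 / q'))
    (hφ.mul ((hm _).mul (hem.pow_const _))).aemeasurable
    ((hm _).mul (hem.pow_const _)).aemeasurable
  have h4 : ∫⁻ s in Ioi (0 : ℝ), (φ s * (ENNReal.ofReal (s ^ α) * e s ^ (1 / q))) ^ q =
      ∫⁻ s in Ioi (0 : ℝ), φ s ^ q * (ENNReal.ofReal (s ^ ((q - 1) / p)) * e s) := by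
    refine setLIntegral_congr_fun measurableSet_Ioi fun s hs => ?_
    have hs0 : (0 : ℝ) < s := hs
    rw [ENNReal.mul_rpow_of_nonneg _ _ hq0.le, ENNReal.mul_rpow_of_nonneg _ _ hq0.le,
      ofReal_rpow_rpow hs0 _ hq0.le, ← ENNReal.rpow_mul, one_div, inv_mul_cancel₀ hq0.ne',
      ENNReal.rpow_one]
    have : α * q = (q - 1) / p := by rw [hα]; field_simp
    rw [this]
  have h5 : ∫⁻ s in Ioi (0 : ℝ), (ENNReal.ofReal (s ^ (-α)) * e s ^ (1 / q')) ^ q' =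
      ENNReal.ofReal (t ^ (-r⁻¹) * Real.Gamma r⁻¹) := by
    rw [← lintegral_rpow_mul_exp_neg (inv_pos.2 hr0) ht]
    refine setLIntegral_congr_fun measurableSet_Ioi fun s hs => ?_
    have hs0 : (0 : ℝ) < s := hs
    rw [ENNReal.mul_rpow_of_nonneg _ _ hq'0.le, ofReal_rpow_rpow hs0 _ hq'0.le,
      ← ENNReal.rpow_mul, one_div, inv_mul_cancel₀ hq'0.ne', ENNReal.rpow_one]
    have : -α * q' = r⁻¹ - 1 := by
      have h6 := hpr.inv_add_inv_eq_one
      have h7 : α * q' = p⁻¹ := by rw [hα, hq']; field_simp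
      linarith
    rw [this]
  rw [← h1, h4, h5] at h3
  refine (ENNReal.rpow_le_rpow h3 hq0.le).trans_eq ?_
  rw [ENNReal.mul_rpow_of_nonneg _ _ hq0.le, ← ENNReal.rpow_mul, ← ENNReal.rpow_mul,
    one_div, inv_mul_cancel₀ hq0.ne', ENNReal.rpow_one, mul_comm]
  congr 2
  rw [hq']; field_simp

/-- The second half of the Schur test. The pointwise bound gives `Γ(1/r)^(q-1)`; after Tonelli the
integral in `t` is another Gamma integral and supplies the last factor. -/
theorem weightedPow_lintegralLaplace_le {p r q : ℝ} (hpr : p.HolderConjugate r) (hq : 1 < q)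
    {φ : ℝ → ℝ≥0∞} (hφ : Measurable φ) :
    weightedPow r q (lintegralLaplace φ) ≤
      ENNReal.ofReal (Real.Gamma r⁻¹) ^ q * weightedPow p q φ := by
  have hq1 : 0 < q - 1 := by linarith
  have hp0 := hpr.pos
  have hr0 := hpr.symm.pos
  set Γ := Real.Gamma r⁻¹ with hΓ
  have hΓ0 : 0 < Γ := Real.Gamma_pos_of_pos (inv_pos.2 hr0)
  have hm : ∀ c : ℝ, Measurable fun t : ℝ => ENNReal.ofReal (t ^ c) := fun c =>
    (measurable_id.pow_const _).ennreal_ofReal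
  calc weightedPow r q (lintegralLaplace φ)
      ≤ ∫⁻ t in Ioi (0 : ℝ), ∫⁻ s in Ioi (0 : ℝ), ENNReal.ofReal Γ ^ (q - 1) *
          ((φ s ^ q * ENNReal.ofReal (s ^ ((q - 1) / p))) * (ENNReal.ofReal (t ^ (r⁻¹ - 1)) *
            ENNReal.ofReal (Real.exp (-(s * t))))) := by
        refine setLIntegral_mono' measurableSet_Ioi fun t ht => ?_
        have ht0 : (0 : ℝ) < t := ht
        refine (mul_le_mul_right (lintegralLaplace_rpow_le hpr hq hφ ht0) _).trans_eq ?_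
        rw [ENNReal.ofReal_mul (by positivity), ENNReal.mul_rpow_of_nonneg _ _ hq1.le,
          ofReal_rpow_rpow ht0 _ hq1.le, ← mul_assoc, ← mul_assoc,
          ofReal_rpow_mul_ofReal_rpow ht0, ← lintegral_const_mul']
        · refine lintegral_congr fun s => ?_
          have e1 : q / r - 1 + -r⁻¹ * (q - 1) = r⁻¹ - 1 := by field_simp; ring
          rw [e1, mul_comm s t]
          ring
        · exact ENNReal.mul_ne_top ENNReal.ofReal_ne_top
            (ENNReal.rpow_ne_top_of_nonneg hq1.le ENNReal.ofReal_ne_top)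
    _ = ∫⁻ s in Ioi (0 : ℝ), ∫⁻ t in Ioi (0 : ℝ), ENNReal.ofReal Γ ^ (q - 1) *
          ((φ s ^ q * ENNReal.ofReal (s ^ ((q - 1) / p))) * (ENNReal.ofReal (t ^ (r⁻¹ - 1)) *
            ENNReal.ofReal (Real.exp (-(s * t))))) := by
        refine lintegral_lintegral_swap (Measurable.aemeasurable ?_)
        refine Measurable.const_mul ?_ _
        refine Measurable.mul ((((hφ.pow_const q).mul (hm _))).comp measurable_snd) ?_
        exact ((hm _).comp measurable_fst).mul (measurable_exp_kernel.comp measurable_swap)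
    _ = ∫⁻ s in Ioi (0 : ℝ), ENNReal.ofReal Γ ^ q *
          (ENNReal.ofReal (s ^ (q / p - 1)) * φ s ^ q) := by
        refine setLIntegral_congr_fun measurableSet_Ioi fun s hs => ?_
        have hs0 : (0 : ℝ) < s := hs
        rw [lintegral_const_mul _ (by fun_prop), lintegral_const_mul _ (by fun_prop),
          lintegral_rpow_mul_exp_neg (inv_pos.2 hr0) hs0, ENNReal.ofReal_mul (by positivity)]
        have e1 : ENNReal.ofReal Γ ^ q = ENNReal.ofReal Γ ^ (q - 1) * ENNReal.ofReal Γ := by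
          conv_rhs => rw [← ENNReal.rpow_one (ENNReal.ofReal Γ), ← ENNReal.rpow_mul, one_mul]
          rw [← ENNReal.rpow_add _ _ (by simpa using hΓ0) ENNReal.ofReal_ne_top, sub_add_cancel]
        have e2 : q / p - 1 = (q - 1) / p + -r⁻¹ := by
          have h6 := hpr.inv_add_inv_eq_one
          have : r⁻¹ = 1 - p⁻¹ := by linarith
          rw [this]; field_simp; ring
        rw [e1, e2, ← ofReal_rpow_mul_ofReal_rpow hs0]
        ring
    _ = _ := by
        rw [lintegral_const_mul' _ _ (ENNReal.rpow_ne_top_of_nonneg (by linarith)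
          ENNReal.ofReal_ne_top), weightedPow]

/-- Hölder's inequality with the weights `s^(1/p-1/q)` and `s^(1/r-1/q')`, whose product is `1`. -/
theorem lintegral_mul_le_weightedPow {p r q q' : ℝ} (hpr : p.HolderConjugate r)
    (hqq : q.HolderConjugate q') {φ ψ : ℝ → ℝ≥0∞} (hφ : Measurable φ) (hψ : Measurable ψ) :
    ∫⁻ s in Ioi (0 : ℝ), φ s * ψ s ≤
      weightedPow p q φ ^ (1 / q) * weightedPow r q' ψ ^ (1 / q') := by
  have hm : ∀ c : ℝ, Measurable fun t : ℝ => ENNReal.ofReal (t ^ c) := fun c =>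
    (measurable_id.pow_const _).ennreal_ofReal
  have hq0 := hqq.pos
  have hq'0 := hqq.symm.pos
  have hp0 := hpr.pos
  have hr0 := hpr.symm.pos
  have h1 := hpr.inv_add_inv_eq_one
  have h2 := hqq.inv_add_inv_eq_one
  have h3 := ENNReal.lintegral_mul_le_Lp_mul_Lq (volume.restrict (Ioi (0 : ℝ))) hqq
    (f := fun s => ENNReal.ofReal (s ^ (p⁻¹ - q⁻¹)) * φ s)
    (g := fun s => ENNReal.ofReal (s ^ (r⁻¹ - q'⁻¹)) * ψ s)
    ((hm _).mul hφ).aemeasurable ((hm _).mul hψ).aemeasurable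
  refine le_trans (le_of_eq ?_) (h3.trans_eq ?_)
  · refine setLIntegral_congr_fun measurableSet_Ioi fun s hs => ?_
    have hs0 : (0 : ℝ) < s := hs
    simp only [Pi.mul_apply]
    rw [mul_mul_mul_comm, ofReal_rpow_mul_ofReal_rpow hs0,
      show p⁻¹ - q⁻¹ + (r⁻¹ - q'⁻¹) = 0 by linarith]
    simp
  · congr 2
    · refine setLIntegral_congr_fun measurableSet_Ioi fun s hs => ?_
      have hs0 : (0 : ℝ) < s := hs
      rw [ENNReal.mul_rpow_of_nonneg _ _ hq0.le, ofReal_rpow_rpow hs0 _ hq0.le,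
        show (p⁻¹ - q⁻¹) * q = q / p - 1 by field_simp]
    · refine setLIntegral_congr_fun measurableSet_Ioi fun s hs => ?_
      have hs0 : (0 : ℝ) < s := hs
      rw [ENNReal.mul_rpow_of_nonneg _ _ hq'0.le, ofReal_rpow_rpow hs0 _ hq'0.le,
        show (r⁻¹ - q'⁻¹) * q' = q' / r - 1 by field_simp]

/-! ### Boundedness of the Laplace transform -/

theorem lintegralLaplace_lt_top {p q : ℝ} (hp : 1 < p) (hq : 1 < q) {φ : ℝ → ℝ≥0∞}
    (hφ : Measurable φ) (h : weightedPow p q φ < ∞) {t : ℝ} (ht : 0 < t) :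
    lintegralLaplace φ t < ∞ := by
  have hpr := Real.HolderConjugate.conjExponent hp
  have hqq := Real.HolderConjugate.conjExponent hq
  refine (lintegral_mul_le_weightedPow hpr hqq hφ (by fun_prop)).trans_lt ?_
  have hq0 := hqq.pos
  have hq'0 := hqq.symm.pos
  have hr0 := hpr.symm.pos
  refine ENNReal.mul_lt_top (ENNReal.rpow_lt_top_of_nonneg (by positivity) h.ne)
    (ENNReal.rpow_lt_top_of_nonneg (by positivity) ?_)
  have : weightedPow (p.conjExponent) q.conjExponent
      (fun s => ENNReal.ofReal (Real.exp (-(t * s)))) =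
      ∫⁻ s in Ioi (0 : ℝ), ENNReal.ofReal (s ^ (q.conjExponent / p.conjExponent - 1)) *
        ENNReal.ofReal (Real.exp (-((t * q.conjExponent) * s))) := by
    refine lintegral_congr fun s => ?_
    rw [ENNReal.ofReal_rpow_of_nonneg (Real.exp_pos _).le hq'0.le, ← Real.exp_mul]
    ring_nf
  rw [this, lintegral_rpow_mul_exp_neg (by positivity) (by positivity)]
  exact ENNReal.ofReal_ne_top

theorem lintegralLaplace_abs_le {f : ℝ → ℝ} (hf : AEMeasurable f halfLine) {t : ℝ}
    (ht : 0 < t) :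
    lintegralLaplace (fun s => ENNReal.ofReal |f s|) t ≤ lintegralLaplace (rearrangement f) t := by
  refine lintegral_abs_mul_le_rearrangement hf (fun s _ u _ hsu => ?_) (by fun_prop)
  gcongr

theorem integrable_laplace {p q : ℝ} (hp : 1 < p) (hq : 1 < q) {f : ℝ → ℝ}
    (hf : AEMeasurable f halfLine) (h : lorentzENorm halfLine p q f < ∞) {t : ℝ} (ht : 0 < t) :
    Integrable (fun s => f s * Real.exp (-(t * s))) halfLine := by
  refine ⟨(hf.mul (by fun_prop)).aestronglyMeasurable, ?_⟩
  have h1 : lintegralLaplace (rearrangement f) t < ∞ := by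
    refine lintegralLaplace_lt_top hp hq (rearrangement_antitone f).measurable ?_ ht
    exact (weightedPow_rearrangement_le (by linarith) (by linarith) f).trans_lt
      (ENNReal.rpow_lt_top_of_nonneg (by linarith) h.ne)
  refine lt_of_eq_of_lt (lintegral_congr fun s => ?_) ((lintegralLaplace_abs_le hf ht).trans_lt h1)
  rw [Real.enorm_eq_ofReal_abs, abs_mul, abs_of_pos (Real.exp_pos _),
    ENNReal.ofReal_mul (abs_nonneg _)]

theorem ofReal_abs_laplaceTransform_le (f : ℝ → ℝ) (t : ℝ) :
    ENNReal.ofReal |laplaceTransform f t| ≤ lintegralLaplace (fun s => ENNReal.ofReal |f s|) t := by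
  rw [← Real.enorm_eq_ofReal_abs]
  refine (enorm_integral_le_lintegral_enorm _).trans_eq (lintegral_congr fun s => ?_)
  rw [Real.enorm_eq_ofReal_abs, abs_mul, abs_of_pos (Real.exp_pos _),
    ENNReal.ofReal_mul (abs_nonneg _)]

theorem lorentzENorm_laplaceTransform_le {p r q : ℝ} (hpr : p.HolderConjugate r) (hq : 1 < q)
    {f : ℝ → ℝ} (hf : AEMeasurable f halfLine) :
    lorentzENorm halfLine r q (laplaceTransform f) ≤
      ENNReal.ofReal (Real.Gamma r⁻¹) * lorentzENorm halfLine p q f := by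
  have hq0 : 0 < q := by linarith
  rw [← ENNReal.rpow_le_rpow_iff hq0, ENNReal.mul_rpow_of_nonneg _ _ hq0.le]
  have hm := (rearrangement_antitone f).measurable
  calc _ ≤ weightedPow r q (lintegralLaplace (rearrangement f)) := by
        refine lorentzENorm_rpow_le_weightedPow hpr.symm.pos hq0
          ((lintegralLaplace_antitone _).antitoneOn _) (measurable_lintegralLaplace hm) ?_
        filter_upwards [ae_restrict_mem measurableSet_Ioi] with t ht
        exact (ofReal_abs_laplaceTransform_le f t).trans (lintegralLaplace_abs_le hf ht)
    _ ≤ _ := weightedPow_lintegralLaplace_le hpr hq hm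
    _ ≤ _ := mul_le_mul_right (weightedPow_rearrangement_le hpr.pos hq0 f) _

/-- Lorentz duality against decreasing functions, where the dual norm is simply a weighted `L^{q'}`
norm. It provides the lower bounds for `‖L x‖`. -/
theorem lintegral_abs_mul_le_lorentzENorm {p r q q' : ℝ} (hpr : p.HolderConjugate r)
    (hqq : q.HolderConjugate q') {f : ℝ → ℝ} (hf : AEMeasurable f halfLine)
    {Q : ℝ → ℝ≥0∞} (hQ : AntitoneOn Q (Ioi 0)) (hQm : Measurable Q) :
    ∫⁻ x in Ioi (0 : ℝ), ENNReal.ofReal |f x| * Q x ≤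
      lorentzENorm halfLine p q f * weightedPow r q' Q ^ (1 / q') := by
  refine (lintegral_abs_mul_le_rearrangement hf hQ hQm).trans
    ((lintegral_mul_le_weightedPow hpr hqq (rearrangement_antitone f).measurable hQm).trans ?_)
  gcongr
  have h := ENNReal.rpow_le_rpow (weightedPow_rearrangement_le hpr.pos hqq.pos f)
    (one_div_nonneg.2 hqq.pos.le)
  rwa [← ENNReal.rpow_mul, mul_one_div, div_self hqq.pos.ne', ENNReal.rpow_one] at h

/-! ### Power functions damped logarithmically around a point -/

theorem lintegral_Ioi_comp_mul_left (F : ℝ → ℝ≥0∞) {c : ℝ} (hc : 0 < c) :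
    ∫⁻ s in Ioi (0 : ℝ), F (c * s) = ENNReal.ofReal c⁻¹ * ∫⁻ s in Ioi (0 : ℝ), F s := by
  have himg : (fun t : ℝ => c⁻¹ * t) '' Ioi 0 = Ioi 0 := by
    rw [Set.image_mul_left_Ioi (inv_pos.2 hc)]; simp
  have key := lintegral_image_eq_lintegral_abs_deriv_mul (s := Ioi (0 : ℝ))
    (f := fun t => c⁻¹ * t) (f' := fun _ => c⁻¹) measurableSet_Ioi
    (fun x _ => by simpa using ((hasDerivAt_id x).const_mul c⁻¹).hasDerivWithinAt)
    (fun x _ y _ hxy => by simpa [hc.ne'] using hxy) (fun s => F (c * s))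
  rw [himg] at key
  rw [key, lintegral_const_mul' _ _ ENNReal.ofReal_ne_top, abs_of_pos (inv_pos.2 hc)]
  congr 1
  refine lintegral_congr fun x => ?_
  rw [mul_inv_cancel_left₀ hc.ne']

/-- The function `u ↦ min(u, 1/u)^η`. -/
noncomputable def peak (η u : ℝ) : ℝ := Real.exp (-η * |Real.log u|)

theorem peak_pos (η u : ℝ) : 0 < peak η u := Real.exp_pos _

theorem peak_le_one {η : ℝ} (hη : 0 ≤ η) (u : ℝ) : peak η u ≤ 1 := by
  rw [peak, Real.exp_le_one_iff]
  nlinarith [abs_nonneg (Real.log u), mul_nonneg hη (abs_nonneg (Real.log u))]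

theorem peak_inv (η u : ℝ) : peak η u⁻¹ = peak η u := by
  rw [peak, Real.log_inv, abs_neg, peak]

theorem peak_mul_peak (η η' u : ℝ) : peak η u * peak η' u = peak (η + η') u := by
  rw [peak, peak, peak, ← Real.exp_add]; ring_nf

theorem peak_rpow (η u c : ℝ) : peak η u ^ c = peak (η * c) u := by
  rw [peak, peak, ← Real.exp_mul]; ring_nf

/-- The triangle inequality for `|log|`. Both the decoupling of distant dilates and the lower bound
for the transform of a damped power rest on it. -/
theorem peak_mul_le {η u v : ℝ} (hη : 0 ≤ η) (hu : 0 < u) (hv : 0 < v) :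
    peak η u * peak η v ≤ peak η (u * v) := by
  rw [peak, peak, peak, ← Real.exp_add, Real.exp_le_exp, Real.log_mul hu.ne' hv.ne']
  nlinarith [abs_add_le (Real.log u) (Real.log v)]

theorem measurable_peak (η : ℝ) : Measurable (peak η) :=
  ((Real.measurable_log.norm).const_mul (-η)).exp

theorem peak_of_le_one {η u : ℝ} (h0 : 0 < u) (h1 : u ≤ 1) : peak η u = u ^ η := by
  rw [peak, abs_of_nonpos (Real.log_nonpos h0.le h1), Real.rpow_def_of_pos h0]; ring_nf

theorem peak_of_one_le {η u : ℝ} (h1 : 1 ≤ u) : peak η u = u ^ (-η) := by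
  rw [peak, abs_of_nonneg (Real.log_nonneg h1), Real.rpow_def_of_pos (by linarith)]; ring_nf

/-- The measure `ds/s` is dilation invariant, so `a` plays no role; each side of `1` contributes
`1/δ`. -/
theorem lintegral_inv_mul_peak {δ a : ℝ} (hδ : 0 < δ) (ha : 0 < a) :
    ∫⁻ s in Ioi (0 : ℝ), ENNReal.ofReal (s ^ (-1 : ℝ) * peak δ (a * s)) =
      ENNReal.ofReal (2 / δ) := by
  have h1 : ∫⁻ s in Ioi (0 : ℝ), ENNReal.ofReal (s ^ (-1 : ℝ) * peak δ (a * s)) =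
      ∫⁻ s in Ioi (0 : ℝ), ENNReal.ofReal (s ^ (-1 : ℝ) * peak δ s) := by
    have e : ∀ s ∈ Ioi (0 : ℝ), ENNReal.ofReal (s ^ (-1 : ℝ) * peak δ (a * s)) =
        ENNReal.ofReal a * ENNReal.ofReal ((a * s) ^ (-1 : ℝ) * peak δ (a * s)) := by
      intro s hs
      have hs0 : (0 : ℝ) < s := hs
      rw [← ENNReal.ofReal_mul ha.le, Real.rpow_neg_one, Real.rpow_neg_one]
      congr 1
      field_simp
    rw [setLIntegral_congr_fun measurableSet_Ioi e, lintegral_const_mul' _ _ ENNReal.ofReal_ne_top,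
      lintegral_Ioi_comp_mul_left (fun u => ENNReal.ofReal (u ^ (-1 : ℝ) * peak δ u)) ha,
      ← mul_assoc, ← ENNReal.ofReal_mul ha.le, mul_inv_cancel₀ ha.ne', ENNReal.ofReal_one, one_mul]
  have hlo : ∫⁻ s in Ioc (0 : ℝ) 1, ENNReal.ofReal (s ^ (-1 : ℝ) * peak δ s) =
      ENNReal.ofReal δ⁻¹ := by
    have hi : IntegrableOn (fun t : ℝ => t ^ (δ - 1)) (Ioc 0 1) := by
      have := (intervalIntegral.intervalIntegrable_rpow' (a := 0) (b := 1)
        (show -1 < δ - 1 by linarith))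
      rwa [intervalIntegrable_iff_integrableOn_Ioc_of_le zero_le_one] at this
    have e : ∀ s ∈ Ioc (0 : ℝ) 1, ENNReal.ofReal (s ^ (-1 : ℝ) * peak δ s) =
        ENNReal.ofReal (s ^ (δ - 1)) := by
      intro s hs
      rw [peak_of_le_one hs.1 hs.2, ← Real.rpow_add hs.1]
      ring_nf
    rw [setLIntegral_congr_fun measurableSet_Ioc e, ← ofReal_integral_eq_lintegral_ofReal hi
      ((ae_restrict_mem measurableSet_Ioc).mono fun t ht => Real.rpow_nonneg (le_of_lt ht.1) _),
      ← intervalIntegral.integral_of_le zero_le_one, integral_rpow (Or.inl (by linarith))]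
    simp [Real.zero_rpow hδ.ne']
  have hhi : ∫⁻ s in Ioi (1 : ℝ), ENNReal.ofReal (s ^ (-1 : ℝ) * peak δ s) =
      ENNReal.ofReal δ⁻¹ := by
    have e : ∀ s ∈ Ioi (1 : ℝ), ENNReal.ofReal (s ^ (-1 : ℝ) * peak δ s) =
        ENNReal.ofReal (s ^ (-δ - 1)) := by
      intro s hs
      have hs1 : (1 : ℝ) < s := hs
      rw [peak_of_one_le hs1.le, ← Real.rpow_add (by linarith)]
      ring_nf
    rw [setLIntegral_congr_fun measurableSet_Ioi e, ← ofReal_integral_eq_lintegral_ofReal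
      (integrableOn_Ioi_rpow_of_lt (by linarith) one_pos)
      ((ae_restrict_mem measurableSet_Ioi).mono fun t ht =>
        Real.rpow_nonneg (zero_le_one.trans (le_of_lt ht)) _),
      integral_Ioi_rpow_of_lt (by linarith) one_pos]
    congr 1
    simp
  rw [h1, ← Ioc_union_Ioi_eq_Ioi zero_le_one, lintegral_union measurableSet_Ioi
    (Ioc_disjoint_Ioi le_rfl), hlo, hhi, ← ENNReal.ofReal_add (by positivity) (by positivity)]
  congr 1
  ring

/-- The function `s ↦ s^(-1/p) * min(as, 1/(as))^η`. -/
noncomputable def dampedPower (p η a s : ℝ) : ℝ := s ^ (-p⁻¹) * peak η (a * s)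

theorem dampedPower_nonneg (p η a : ℝ) {s : ℝ} (hs : 0 < s) : 0 ≤ dampedPower p η a s :=
  mul_nonneg (Real.rpow_nonneg hs.le _) (peak_pos _ _).le

theorem measurable_dampedPower (p η a : ℝ) : Measurable (dampedPower p η a) :=
  (measurable_id.pow_const _).mul ((measurable_peak η).comp (measurable_const_mul a))

/-- On the logarithmic scale the damping has slope at most `η`, which the slope `-1/p` of the power
absorbs. -/
theorem dampedPower_antitoneOn {p η a : ℝ} (hη : 0 ≤ η) (hηp : η ≤ p⁻¹) (ha : 0 < a) :
    AntitoneOn (dampedPower p η a) (Ioi 0) := by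
  intro s hs u hu hsu
  have hs0 : (0 : ℝ) < s := hs
  have hu0 : (0 : ℝ) < u := hu
  rw [dampedPower, dampedPower, peak, peak, Real.rpow_def_of_pos hs0, Real.rpow_def_of_pos hu0,
    ← Real.exp_add, ← Real.exp_add, Real.exp_le_exp, Real.log_mul ha.ne' hs0.ne',
    Real.log_mul ha.ne' hu0.ne']
  have h1 := Real.log_le_log hs0 hsu
  have h2 : |Real.log a + Real.log s| ≤ |Real.log a + Real.log u| + (Real.log u - Real.log s) := by
    have := abs_sub_abs_le_abs_sub (Real.log a + Real.log s) (Real.log a + Real.log u)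
    rw [show Real.log a + Real.log s - (Real.log a + Real.log u) =
      -(Real.log u - Real.log s) by ring, abs_neg, abs_of_nonneg (sub_nonneg.2 h1)] at this
    linarith
  nlinarith [mul_le_mul_of_nonneg_left h2 hη, mul_le_mul_of_nonneg_right hηp (sub_nonneg.2 h1)]

/-! ### Sparse dilates -/

/-- A rapidly increasing sequence of dilation factors. -/
noncomputable def sparseFactor (B : ℝ) (i : ℕ) : ℝ := Real.exp (B * (2 ^ i - 1))

theorem sparseFactor_pos (B : ℝ) (i : ℕ) : 0 < sparseFactor B i := Real.exp_pos _

theorem sparseFactor_zero (B : ℝ) : sparseFactor B 0 = 1 := by simp [sparseFactor]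

/-- The bound involves only `j`, so the resulting geometric series in `j` is uniform in `i`. -/
theorem half_le_abs_two_pow_sub {i j : ℕ} (hij : i ≠ j) :
    ((j : ℝ) + 1) / 2 ≤ |(2 : ℝ) ^ i - 2 ^ j| := by
  have hj : (j : ℝ) + 1 ≤ 2 ^ j := by exact_mod_cast Nat.lt_two_pow_self (n := j)
  rcases lt_or_gt_of_ne hij with h | h
  · have : (2 : ℝ) ^ (i + 1) ≤ 2 ^ j := pow_le_pow_right₀ one_le_two h
    rw [pow_succ] at this
    rw [abs_sub_comm]
    exact le_trans (by linarith) (le_abs_self _)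
  · have : (2 : ℝ) ^ (j + 1) ≤ 2 ^ i := pow_le_pow_right₀ one_le_two h
    rw [pow_succ] at this
    exact le_trans (by linarith) (le_abs_self _)

/-- At any point the largest summand is at most `1`, while the others are bounded by a geometric
series that is small for large `B`. -/
theorem exists_sum_peak_le {γ ε : ℝ} (hγ : 0 < γ) (hε : 0 < ε) :
    ∃ B₀ : ℝ, ∀ B ≥ B₀, ∀ (S : Finset ℕ) (s : ℝ), 0 < s →
      ∑ i ∈ S, peak γ (sparseFactor B i * s) ≤ 1 + ε := by
  refine ⟨4 / γ * Real.log ((1 + ε) / ε), fun B hB S s hs => ?_⟩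
  have hlog : 0 < Real.log ((1 + ε) / ε) := Real.log_pos (by rw [lt_div_iff₀ hε]; linarith)
  have hB0 : 0 ≤ B := le_trans (by positivity) hB
  rcases S.eq_empty_or_nonempty with rfl | hS
  · simpa using by linarith
  obtain ⟨i, hi, hmax⟩ := S.exists_max_image (fun i => peak γ (sparseFactor B i * s)) hS
  set r := Real.exp (-(γ * B / 4)) with hr
  have hr0 : 0 < r := Real.exp_pos _
  have hrε : r ≤ ε / (1 + ε) := by
    rw [hr, ← Real.le_log_iff_exp_le (by positivity), ← inv_div (1 + ε), Real.log_inv]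
    have := mul_le_mul_of_nonneg_left hB (show (0 : ℝ) ≤ γ / 4 by positivity)
    have e : γ / 4 * (4 / γ * Real.log ((1 + ε) / ε)) = Real.log ((1 + ε) / ε) := by field_simp
    linarith
  have hr1 : r < 1 := hrε.trans_lt (by rw [div_lt_one (by linarith)]; linarith)
  have hoff : ∀ j ∈ S.erase i, peak γ (sparseFactor B j * s) ≤ r * r ^ j := by
    intro j hj
    obtain ⟨hji, hjS⟩ := Finset.mem_erase.1 hj
    have hle := hmax j hjS
    have hpj := peak_pos γ (sparseFactor B j * s)
    -- As summand `i` is the largest, the square of summand `j` is at most the product of the two,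
    -- and this depends only on the ratio of the two dilation factors.
    have h1 : peak γ (sparseFactor B j * s) ^ 2 ≤ (r * r ^ j) ^ 2 := by
      calc peak γ (sparseFactor B j * s) ^ 2
          ≤ peak γ (sparseFactor B i * s) * peak γ (sparseFactor B j * s)⁻¹ := by
            rw [peak_inv, sq]; gcongr
        _ ≤ peak γ (sparseFactor B i * s * (sparseFactor B j * s)⁻¹) :=
            peak_mul_le hγ.le (mul_pos (sparseFactor_pos _ _) hs)
              (inv_pos.2 (mul_pos (sparseFactor_pos _ _) hs))
        _ = Real.exp (-γ * (B * |(2 : ℝ) ^ i - 2 ^ j|)) := by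
            rw [mul_inv, mul_mul_mul_comm, mul_inv_cancel₀ hs.ne', mul_one, peak, sparseFactor,
              sparseFactor, ← Real.exp_neg, ← Real.exp_add, Real.log_exp, ← mul_neg, ← mul_add,
              abs_mul, abs_of_nonneg hB0]
            ring_nf
        _ ≤ _ := by
            rw [← pow_succ', hr, ← Real.exp_nat_mul, ← Real.exp_nat_mul, Real.exp_le_exp]
            have := half_le_abs_two_pow_sub hji.symm
            have h3 := mul_le_mul_of_nonneg_left this (mul_nonneg hγ.le hB0)
            push_cast
            nlinarith
    exact (pow_le_pow_iff_left₀ hpj.le (by positivity) two_ne_zero).1 h1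
  have hgeo : ∑ j ∈ S.erase i, r * r ^ j ≤ r * (1 - r)⁻¹ := by
    rw [← Finset.mul_sum]
    refine mul_le_mul_of_nonneg_left ?_ hr0.le
    rw [← tsum_geometric_of_lt_one hr0.le hr1]
    exact (summable_geometric_of_lt_one hr0.le hr1).sum_le_tsum _ fun j _ => by positivity
  rw [← Finset.add_sum_erase S _ hi]
  refine add_le_add (peak_le_one hγ.le _) ((Finset.sum_le_sum hoff).trans (hgeo.trans ?_))
  rw [← div_eq_mul_inv, div_le_iff₀ (by linarith)]
  rw [le_div_iff₀ (by linarith)] at hrε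
  linarith

/-- Hölder's inequality after splitting each peak into its powers `τ` and `1 - τ`. The first is the
weight with sum at most `σ`; for small `τ` the exponent `q - τ * (q - 1)` is almost `q`, so almost
nothing is lost. -/
theorem sum_mul_peak_rpow_le {q η τ σ : ℝ} (hq : 1 < q) {a : ℕ → ℝ} {S : Finset ℕ} {s : ℝ}
    (h : ∑ i ∈ S, peak (η * τ) (a i * s) ≤ σ) (c : ℕ → ℝ) :
    (∑ i ∈ S, |c i| * peak η (a i * s)) ^ q ≤
      σ ^ (q - 1) * ∑ i ∈ S, |c i| ^ q * peak (η * (q - τ * (q - 1))) (a i * s) := by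
  have hq0 : 0 < q := by linarith
  have hJ := Real.inner_le_weight_mul_Lp_of_nonneg S hq.le (fun i => peak (η * τ) (a i * s))
    (fun i => |c i| * peak (η * (1 - τ)) (a i * s)) (fun i => (peak_pos _ _).le)
    (fun i => mul_nonneg (abs_nonneg _) (peak_pos _ _).le)
  have e1 : ∑ i ∈ S, peak (η * τ) (a i * s) * (|c i| * peak (η * (1 - τ)) (a i * s)) =
      ∑ i ∈ S, |c i| * peak η (a i * s) := by
    refine Finset.sum_congr rfl fun i _ => ?_
    rw [mul_left_comm, peak_mul_peak]
    ring_nf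
  have e2 : ∑ i ∈ S, peak (η * τ) (a i * s) * (|c i| * peak (η * (1 - τ)) (a i * s)) ^ q =
      ∑ i ∈ S, |c i| ^ q * peak (η * (q - τ * (q - 1))) (a i * s) := by
    refine Finset.sum_congr rfl fun i _ => ?_
    rw [Real.mul_rpow (abs_nonneg _) (peak_pos _ _).le, peak_rpow, mul_left_comm, peak_mul_peak]
    ring_nf
  rw [e1, e2] at hJ
  have hw : 0 ≤ ∑ i ∈ S, peak (η * τ) (a i * s) :=
    Finset.sum_nonneg fun i _ => (peak_pos _ _).le
  have hX : 0 ≤ ∑ i ∈ S, |c i| ^ q * peak (η * (q - τ * (q - 1))) (a i * s) :=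
    Finset.sum_nonneg fun i _ => mul_nonneg (by positivity) (peak_pos _ _).le
  have hL : 0 ≤ ∑ i ∈ S, |c i| * peak η (a i * s) :=
    Finset.sum_nonneg fun i _ => mul_nonneg (abs_nonneg _) (peak_pos _ _).le
  refine (Real.rpow_le_rpow hL hJ hq0.le).trans ?_
  rw [Real.mul_rpow (by positivity) (by positivity), ← Real.rpow_mul hw, ← Real.rpow_mul hX,
    inv_mul_cancel₀ hq0.ne', Real.rpow_one, show (1 - q⁻¹) * q = q - 1 by field_simp]
  gcongr

theorem exists_weight_exponent {q α : ℝ} (hq : 1 < q) (hα : 1 < α) :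
    ∃ τ : ℝ, 0 < τ ∧ τ ≤ 1 ∧ (1 + τ) ^ (q - 1) * (q / (q - τ * (q - 1))) ≤ α := by
  have hc : ContinuousAt (fun τ : ℝ => (1 + τ) ^ (q - 1) * (q / (q - τ * (q - 1)))) 0 := by
    refine ContinuousAt.mul ?_ ?_
    · exact ContinuousAt.rpow_const (by fun_prop) (Or.inl (by norm_num))
    · refine ContinuousAt.div (by fun_prop) (by fun_prop) ?_
      simp; linarith
  have h0 : (fun τ : ℝ => (1 + τ) ^ (q - 1) * (q / (q - τ * (q - 1)))) 0 < α := by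
    have : q / q = 1 := div_self (by linarith)
    simpa [this] using hα
  have h1 := (hc.eventually_lt_const h0).filter_mono (nhdsWithin_le_nhds (s := Ioi 0))
  have h2 : ∀ᶠ τ : ℝ in nhdsWithin 0 (Ioi 0), τ ∈ Ioc (0 : ℝ) 1 := Ioc_mem_nhdsGT one_pos
  obtain ⟨τ, h3, h4⟩ := (h1.and h2).exists
  exact ⟨τ, h4.1, h4.2, h3.le⟩

/-- The weighted norm of a combination of sparse dilates is almost an `ℓ^q` norm. -/
theorem exists_weightedPow_sum_le (p : ℝ) {q δ α : ℝ} (hq : 1 < q) (hδ : 0 < δ) (hα : 1 < α) :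
    ∃ B₀ : ℝ, ∀ B ≥ B₀, ∀ a : ℕ → ℝ, (∀ i, a i = sparseFactor B i) ∨
      (∀ i, a i = (sparseFactor B i)⁻¹) → ∀ (S : Finset ℕ) (c : ℕ → ℝ),
      weightedPow p q (fun s => ENNReal.ofReal (∑ i ∈ S, |c i| * dampedPower p (δ / q) (a i) s)) ≤
        ENNReal.ofReal (α * (2 / δ * ∑ i ∈ S, |c i| ^ q)) := by
  have hq0 : 0 < q := by linarith
  -- The order of choice matters: `τ` fixes the total loss `α`, and only then is the sparsity `B`
  -- taken large enough for the sum of the weights to be at most `1 + τ`.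
  obtain ⟨τ, hτ0, hτ1, hτ⟩ := exists_weight_exponent hq hα
  obtain ⟨B₀, hB₀⟩ := exists_sum_peak_le (γ := δ / q * τ) (by positivity) hτ0
  refine ⟨B₀, fun B hB a ha S c => ?_⟩
  have ha0 : ∀ i, 0 < a i := fun i => by
    rcases ha with h | h
    · rw [h]; exact sparseFactor_pos _ _
    · rw [h]; exact inv_pos.2 (sparseFactor_pos _ _)
  have hsum : ∀ s : ℝ, 0 < s → ∑ i ∈ S, peak (δ / q * τ) (a i * s) ≤ 1 + τ := by
    intro s hs
    rcases ha with h | h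
    · simp_rw [h]; exact hB₀ B hB S s hs
    -- Inverse factors reduce to the direct ones under `s ↦ s⁻¹`, because a peak is invariant under
    -- inversion.
    · refine le_of_eq_of_le (Finset.sum_congr rfl fun i _ => ?_) (hB₀ B hB S s⁻¹ (inv_pos.2 hs))
      rw [h, ← peak_inv, mul_inv, inv_inv]
  have hκ : 0 < q - τ * (q - 1) := by nlinarith
  set κ := δ / q * (q - τ * (q - 1)) with hκdef
  have hκ0 : 0 < κ := by positivity
  calc weightedPow p q (fun s =>
        ENNReal.ofReal (∑ i ∈ S, |c i| * dampedPower p (δ / q) (a i) s))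
      ≤ ∫⁻ s in Ioi (0 : ℝ), ∑ i ∈ S, ENNReal.ofReal ((1 + τ) ^ (q - 1) * |c i| ^ q) *
          ENNReal.ofReal (s ^ (-1 : ℝ) * peak κ (a i * s)) := by
        refine setLIntegral_mono' measurableSet_Ioi fun s hs => ?_
        have hs0 : (0 : ℝ) < s := hs
        have hp1 : ∀ i, 0 ≤ |c i| * peak (δ / q) (a i * s) := fun i =>
          mul_nonneg (abs_nonneg _) (peak_pos _ _).le
        have e1 : ∑ i ∈ S, |c i| * dampedPower p (δ / q) (a i) s =
            s ^ (-p⁻¹) * ∑ i ∈ S, |c i| * peak (δ / q) (a i * s) := by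
          rw [Finset.mul_sum]
          exact Finset.sum_congr rfl fun i _ => by rw [dampedPower]; ring
        beta_reduce
        rw [e1, ENNReal.ofReal_rpow_of_nonneg (mul_nonneg (by positivity)
          (Finset.sum_nonneg fun i _ => hp1 i)) hq0.le, ← ENNReal.ofReal_mul (by positivity),
          Real.mul_rpow (by positivity) (Finset.sum_nonneg fun i _ => hp1 i), ← mul_assoc,
          ← Real.rpow_mul hs0.le, ← Real.rpow_add hs0,
          show q / p - 1 + -p⁻¹ * q = -1 by ring]
        simp_rw [← ENNReal.ofReal_mul (show (0 : ℝ) ≤ (1 + τ) ^ (q - 1) * |c _| ^ q by positivity)]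
        rw [← ENNReal.ofReal_sum_of_nonneg]
        · refine ENNReal.ofReal_le_ofReal ?_
          refine (mul_le_mul_of_nonneg_left (sum_mul_peak_rpow_le hq (hsum s hs0) c)
            (by positivity)).trans_eq ?_
          rw [Finset.mul_sum, Finset.mul_sum]
          exact Finset.sum_congr rfl fun i _ => by ring
        · intro i _
          have := peak_pos κ (a i * s)
          positivity
    _ = ∑ i ∈ S, ENNReal.ofReal ((1 + τ) ^ (q - 1) * |c i| ^ q) * ENNReal.ofReal (2 / κ) := by
        rw [lintegral_finsetSum]
        · refine Finset.sum_congr rfl fun i _ => ?_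
          rw [lintegral_const_mul' _ _ ENNReal.ofReal_ne_top,
            lintegral_inv_mul_peak hκ0 (ha0 i)]
        · intro i _
          exact (((measurable_id.pow_const _).mul ((measurable_peak κ).comp
            (measurable_const_mul (a i)))).ennreal_ofReal).const_mul _
    _ = ENNReal.ofReal (((1 + τ) ^ (q - 1) * (q / (q - τ * (q - 1)))) *
          (2 / δ * ∑ i ∈ S, |c i| ^ q)) := by
        rw [← Finset.sum_mul, ← ENNReal.ofReal_sum_of_nonneg (fun i _ => by positivity),
          ← ENNReal.ofReal_mul (Finset.sum_nonneg fun i _ => by positivity), ← Finset.mul_sum]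
        congr 1
        rw [hκdef]
        field_simp
    _ ≤ _ := by
        refine ENNReal.ofReal_le_ofReal (mul_le_mul_of_nonneg_right hτ ?_)
        exact mul_nonneg (by positivity) (Finset.sum_nonneg fun i _ => by positivity)

/-! ### Lower estimates for the Laplace transform -/

/-- The value at `1` of the Laplace transform of a damped power. -/
noncomputable def dampedGamma (p η : ℝ) : ℝ≥0∞ :=
  ∫⁻ u in Ioi (0 : ℝ), ENNReal.ofReal (dampedPower p η 1 u) * ENNReal.ofReal (Real.exp (-u))

/-- After the substitution `u = t s` the damping is `peak η (a u / t)`, which is at least `peak η (t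
/ a) * peak η u`. Thus the transform dominates a damped power of index `r` with inverse dilation
factor. -/
theorem dampedGamma_mul_le {p r η a t : ℝ} (hpr : p.HolderConjugate r) (hη : 0 ≤ η)
    (ha : 0 < a) (ht : 0 < t) :
    ENNReal.ofReal (dampedPower r η a⁻¹ t) * dampedGamma p η ≤
      lintegralLaplace (fun s => ENNReal.ofReal (dampedPower p η a s)) t := by
  have hinv : dampedGamma p η = ENNReal.ofReal t * ∫⁻ s in Ioi (0 : ℝ),
      ENNReal.ofReal (dampedPower p η 1 (t * s)) * ENNReal.ofReal (Real.exp (-(t * s))) := by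
    rw [lintegral_Ioi_comp_mul_left (fun u => ENNReal.ofReal (dampedPower p η 1 u) *
      ENNReal.ofReal (Real.exp (-u))) ht, ← mul_assoc, ← ENNReal.ofReal_mul ht.le,
      mul_inv_cancel₀ ht.ne', ENNReal.ofReal_one, one_mul, dampedGamma]
  rw [hinv, ← mul_assoc, ← lintegral_const_mul' _ _
    (ENNReal.mul_ne_top ENNReal.ofReal_ne_top ENNReal.ofReal_ne_top)]
  refine setLIntegral_mono' measurableSet_Ioi fun s hs => ?_
  have hs0 : (0 : ℝ) < s := hs
  rw [← mul_assoc]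
  refine mul_le_mul_left ?_ _
  rw [← ENNReal.ofReal_mul (dampedPower_nonneg _ _ _ ht), ← ENNReal.ofReal_mul
    (mul_nonneg (dampedPower_nonneg _ _ _ ht) ht.le)]
  refine ENNReal.ofReal_le_ofReal ?_
  have hpow : t ^ (-r⁻¹) * t * (t * s) ^ (-p⁻¹) = s ^ (-p⁻¹) := by
    rw [Real.mul_rpow ht.le hs0.le, ← mul_assoc]
    have : t ^ (-r⁻¹) * t * t ^ (-p⁻¹) = 1 := by
      nth_rewrite 2 [← Real.rpow_one t]
      rw [← Real.rpow_add ht, ← Real.rpow_add ht]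
      have := hpr.inv_add_inv_eq_one
      rw [show -r⁻¹ + 1 + -p⁻¹ = 0 by linarith, Real.rpow_zero]
    rw [this, one_mul]
  have hpk : peak η (a⁻¹ * t) * peak η (1 * (t * s)) ≤ peak η (a * s) := by
    rw [← peak_inv η (a⁻¹ * t)]
    refine (peak_mul_le hη (by positivity) (by positivity)).trans_eq ?_
    congr 1
    field_simp
  calc dampedPower r η a⁻¹ t * t * dampedPower p η 1 (t * s)
      = (t ^ (-r⁻¹) * t * (t * s) ^ (-p⁻¹)) * (peak η (a⁻¹ * t) * peak η (1 * (t * s))) := by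
        rw [dampedPower, dampedPower]; ring
    _ ≤ dampedPower p η a s := by
        rw [hpow, dampedPower]
        exact mul_le_mul_of_nonneg_left hpk (by positivity)

/-- Removing the damping gives the integral for `Γ(1/r)`, by dominated convergence. -/
theorem eventually_lt_dampedGamma {p r : ℝ} (hpr : p.HolderConjugate r) {c : ℝ} (hc0 : 0 ≤ c)
    (hc : c < Real.Gamma r⁻¹) :
    ∀ᶠ η : ℝ in nhdsWithin 0 (Ioi 0), ENNReal.ofReal c < dampedGamma p η := by
  have hr0 := hpr.symm.pos
  have hΓ : ∫⁻ u in Ioi (0 : ℝ), ENNReal.ofReal (u ^ (-p⁻¹)) * ENNReal.ofReal (Real.exp (-u)) =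
      ENNReal.ofReal (Real.Gamma r⁻¹) := by
    have h := lintegral_rpow_mul_exp_neg (inv_pos.2 hr0) one_pos
    have e := hpr.inv_add_inv_eq_one
    rw [show r⁻¹ - 1 = -p⁻¹ by linarith] at h
    simpa using h
  have hlim : Filter.Tendsto (fun η => dampedGamma p η) (nhdsWithin 0 (Ioi 0))
      (nhds (ENNReal.ofReal (Real.Gamma r⁻¹))) := by
    rw [← hΓ]
    refine tendsto_lintegral_filter_of_dominated_convergence
      (fun u => ENNReal.ofReal (u ^ (-p⁻¹)) * ENNReal.ofReal (Real.exp (-u))) ?_ ?_ ?_ ?_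
    · exact Filter.Eventually.of_forall fun η =>
        (measurable_dampedPower p η 1).ennreal_ofReal.mul (by fun_prop)
    · filter_upwards [self_mem_nhdsWithin] with η hη
      filter_upwards [ae_restrict_mem measurableSet_Ioi] with u hu
      have hu0 : (0 : ℝ) < u := hu
      refine mul_le_mul_left (ENNReal.ofReal_le_ofReal ?_) _
      exact mul_le_of_le_one_right (by positivity) (peak_le_one (le_of_lt hη) _)
    · rw [hΓ]; exact ENNReal.ofReal_ne_top
    · refine Filter.Eventually.of_forall fun u => ?_
      refine ENNReal.Tendsto.mul_const (ENNReal.tendsto_ofReal ?_) (Or.inr ENNReal.ofReal_ne_top)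
      have hcont : Continuous fun η : ℝ => dampedPower p η 1 u := by
        unfold dampedPower peak; fun_prop
      have h := (hcont.tendsto 0).mono_left (nhdsWithin_le_nhds (s := Ioi 0))
      simpa [dampedPower, peak] using h
  exact hlim.eventually_const_lt ((ENNReal.ofReal_lt_ofReal_iff_of_nonneg hc0).2 hc)

/-- A diagonal term of the pairing. The exponents `δ/q` and `δ/q'` add up to `δ` and the powers
combine to `t⁻¹`, which leaves the invariant integral `2/δ`. -/
theorem dampedGamma_mul_le_lintegral {p r q q' δ a : ℝ} (hpr : p.HolderConjugate r)
    (hqq : q.HolderConjugate q') (hδ : 0 < δ) (ha : 0 < a) :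
    dampedGamma p (δ / q) * ENNReal.ofReal (2 / δ) ≤ ∫⁻ t in Ioi (0 : ℝ),
      lintegralLaplace (fun s => ENNReal.ofReal (dampedPower p (δ / q) a s)) t *
        ENNReal.ofReal (dampedPower p (δ / q') a⁻¹ t) := by
  have hq0 := hqq.pos
  rw [← lintegral_inv_mul_peak hδ (inv_pos.2 ha), ← lintegral_const_mul]
  · refine setLIntegral_mono' measurableSet_Ioi fun t ht => ?_
    have ht0 : (0 : ℝ) < t := ht
    refine le_trans (le_of_eq ?_) (mul_le_mul_left (dampedGamma_mul_le hpr (by positivity) ha ht0) _)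
    rw [mul_right_comm, ← ENNReal.ofReal_mul (dampedPower_nonneg _ _ _ ht0), mul_comm]
    congr 2
    have h1 := hpr.inv_add_inv_eq_one
    have h2 := hqq.inv_add_inv_eq_one
    have e : δ = δ / q + δ / q' := by rw [div_eq_mul_inv, div_eq_mul_inv, ← mul_add, h2, mul_one]
    rw [dampedPower, dampedPower, mul_mul_mul_comm, ← Real.rpow_add ht0, peak_mul_peak, ← e,
      show -r⁻¹ + -p⁻¹ = -1 by linarith]
  · exact ((measurable_id.pow_const _).mul ((measurable_peak δ).comp
      (measurable_const_mul _))).ennreal_ofReal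

/-- In the sum of the signed and the absolute double sums each term has coefficient `c i * d j + |c
i * d j| ≥ 0`. Off-diagonal terms can therefore be dropped, and alignment doubles the diagonal ones.
-/
theorem two_mul_sum_le_of_aligned {ι : Type*} (S : Finset ι) {c d x y : ι → ℝ}
    (hcd : ∀ i, c i * d i = |c i| * |d i|) (hx : ∀ i, 0 ≤ x i) (hy : ∀ i, 0 ≤ y i) :
    2 * ∑ i ∈ S, |c i| * |d i| * (x i * y i) ≤
      |∑ i ∈ S, c i * x i| * (∑ i ∈ S, |d i| * y i) +
        (∑ i ∈ S, |c i| * x i) * (∑ i ∈ S, |d i| * y i) := by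
  have h1 : (∑ i ∈ S, c i * x i) * (∑ i ∈ S, d i * y i) ≤
      |∑ i ∈ S, c i * x i| * (∑ i ∈ S, |d i| * y i) := by
    refine (le_abs_self _).trans ?_
    rw [abs_mul]
    refine mul_le_mul_of_nonneg_left ((Finset.abs_sum_le_sum_abs _ _).trans_eq ?_) (abs_nonneg _)
    exact Finset.sum_congr rfl fun i _ => by rw [abs_mul, abs_of_nonneg (hy i)]
  refine le_trans ?_ (add_le_add_left h1 _)
  rw [Finset.sum_mul_sum, Finset.sum_mul_sum, ← Finset.sum_add_distrib, Finset.mul_sum]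
  refine Finset.sum_le_sum fun i hi => ?_
  rw [← Finset.sum_add_distrib]
  have hterm : ∀ j ∈ S, 0 ≤ c i * x i * (d j * y j) + |c i| * x i * (|d j| * y j) := by
    intro j _
    have e : c i * x i * (d j * y j) + |c i| * x i * (|d j| * y j) =
        (c i * d j + |c i * d j|) * (x i * y j) := by rw [abs_mul]; ring
    rw [e]
    exact mul_nonneg (by linarith [neg_abs_le (c i * d j)]) (mul_nonneg (hx i) (hy j))
  refine le_trans (le_of_eq ?_) (Finset.single_le_sum hterm hi)
  rw [show c i * x i * (d i * y i) = c i * d i * (x i * y i) by ring, hcd]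
  ring

/-- The norming functional of `ℓ^q`, namely `d = sign c * |c|^(q-1)`. -/
theorem exists_aligned {q : ℝ} (hq : 1 < q) (c : ℝ) :
    ∃ d : ℝ, c * d = |c| * |d| ∧ |c| * |d| = |c| ^ q ∧ |d| ^ (q / (q - 1)) = |c| ^ q := by
  have h0 : |SignType.sign c * |c| ^ (q - 1)| = |c| ^ (q - 1) := by
    rcases eq_or_ne c 0 with rfl | hc
    · simp [Real.zero_rpow (by linarith : q - 1 ≠ 0)]
    · have : |((SignType.sign c : SignType) : ℝ)| = 1 := by
        rcases lt_or_gt_of_ne hc with h | h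
        · simp [sign_neg h]
        · simp [sign_pos h]
      rw [abs_mul, this, one_mul, abs_of_nonneg (by positivity)]
  refine ⟨SignType.sign c * |c| ^ (q - 1), ?_, ?_, ?_⟩
  · rw [h0, ← mul_assoc, self_mul_sign]
  · rw [h0]
    rcases eq_or_ne c 0 with rfl | hc
    · simp [Real.zero_rpow (by linarith : q ≠ 0)]
    · nth_rewrite 1 [← Real.rpow_one |c|]
      rw [← Real.rpow_add (abs_pos.2 hc)]
      ring_nf
  · rw [h0, ← Real.rpow_mul (abs_nonneg _)]
    congr 1
    have : q - 1 ≠ 0 := by linarith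
    field_simp

theorem sum_mul_dampedPower_antitoneOn {p η : ℝ} (hη : 0 ≤ η) (hηp : η ≤ p⁻¹) {a : ℕ → ℝ}
    (ha : ∀ i, 0 < a i) (S : Finset ℕ) (c : ℕ → ℝ) :
    AntitoneOn (fun s => ENNReal.ofReal (∑ i ∈ S, |c i| * dampedPower p η (a i) s)) (Ioi 0) :=
  fun _ hs _ hu hsu => ENNReal.ofReal_le_ofReal <| Finset.sum_le_sum fun i _ =>
    mul_le_mul_of_nonneg_left (dampedPower_antitoneOn hη hηp (ha i) hs hu hsu) (abs_nonneg _)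

theorem measurable_sum_mul_dampedPower (p η : ℝ) (a : ℕ → ℝ) (S : Finset ℕ) (c : ℕ → ℝ) :
    Measurable (fun s => ∑ i ∈ S, c i * dampedPower p η (a i) s) :=
  Finset.measurable_fun_sum _ fun i _ => (measurable_dampedPower p η (a i)).const_mul _

theorem measurable_laplaceTransform {f : ℝ → ℝ} (hf : Measurable f) :
    Measurable (laplaceTransform f) := by
  have h : StronglyMeasurable fun z : ℝ × ℝ => f z.2 * Real.exp (-(z.1 * z.2)) :=
    ((hf.comp measurable_snd).mul (by fun_prop)).stronglyMeasurable
  exact (h.integral_prod_right (ν := volume.restrict (Ioi (0 : ℝ)))).measurable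

theorem laplaceTransform_sum {f : ℕ → ℝ → ℝ} {t : ℝ}
    (hf : ∀ i, Integrable (fun s => f i s * Real.exp (-(t * s))) halfLine)
    (S : Finset ℕ) (c : ℕ → ℝ) :
    laplaceTransform (fun s => ∑ i ∈ S, c i * f i s) t =
      ∑ i ∈ S, c i * laplaceTransform (f i) t := by
  simp only [laplaceTransform, Finset.sum_mul]
  rw [integral_finsetSum]
  · refine Finset.sum_congr rfl fun i _ => ?_
    rw [← integral_const_mul]
    simp only [mul_assoc]
  · intro i _
    simpa only [mul_assoc] using (hf i).const_mul (c i)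

theorem ofReal_laplaceTransform {f : ℝ → ℝ} {t : ℝ} (h0 : ∀ s, 0 < s → 0 ≤ f s)
    (hf : Integrable (fun s => f s * Real.exp (-(t * s))) halfLine) :
    ENNReal.ofReal (laplaceTransform f t) = lintegralLaplace (fun s => ENNReal.ofReal (f s)) t := by
  rw [laplaceTransform, ofReal_integral_eq_lintegral_ofReal hf]
  · exact lintegral_congr fun s => ENNReal.ofReal_mul' (Real.exp_pos _).le
  · filter_upwards [ae_restrict_mem measurableSet_Ioi] with s hs
    exact mul_nonneg (h0 s hs) (Real.exp_pos _).le

theorem le_rpow_one_div {q : ℝ} (hq : 0 < q) {x y : ℝ≥0∞} (h : x ^ q ≤ y) : x ≤ y ^ (1 / q) := by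
  have h1 := ENNReal.rpow_le_rpow h (one_div_nonneg.2 hq.le)
  rwa [← ENNReal.rpow_mul, mul_one_div, div_self hq.ne', ENNReal.rpow_one] at h1

/-- Sparse dilates of a damped power span a subspace on which the Laplace transform almost
attains its norm. -/
theorem exists_sparse_dampedPower {p r q β : ℝ} (hpr : p.HolderConjugate r) (hq : 1 < q)
    (hβ0 : 0 < β) (hβ : β < Real.Gamma r⁻¹) :
    ∃ (η M : ℝ) (a : ℕ → ℝ), 0 < M ∧ a 0 = 1 ∧ (∀ i, 0 < a i) ∧
      ∀ (S : Finset ℕ) (c : ℕ → ℝ),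
        lorentzENorm halfLine p q (fun s => ∑ i ∈ S, c i * dampedPower p η (a i) s) ≤
          ENNReal.ofReal (M * ∑ i ∈ S, |c i| ^ q) ^ (1 / q) ∧
        ENNReal.ofReal β * ENNReal.ofReal (M * ∑ i ∈ S, |c i| ^ q) ^ (1 / q) ≤
          lorentzENorm halfLine r q
            (laplaceTransform fun s => ∑ i ∈ S, c i * dampedPower p η (a i) s) := by
  set q' := q / (q - 1) with hq'
  have hqq : q.HolderConjugate q' := Real.HolderConjugate.conjExponent hq
  have hq0 := hqq.pos
  have hq'0 := hqq.symm.pos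
  have hq'1 : 1 < q' := hqq.symm.lt
  have hp0 := hpr.pos
  have hr0 := hpr.symm.pos
  set Γ := Real.Gamma r⁻¹ with hΓ
  -- The midpoint of `(β + Γ)/2` and `Γ`. Being below `Γ`, it is reached by `dampedGamma`; being
  -- above `(β + Γ)/2`, it leaves room for a loss `α > 1` with `2 * κ = α * (β + Γ)`.
  set κ := (β + 3 * Γ) / 4 with hκ
  have hκ0 : 0 < κ := by rw [hκ]; linarith
  set α := 2 * κ / (β + Γ) with hα
  have hα1 : 1 < α := by rw [hα, lt_div_iff₀ (by linarith), hκ]; linarith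
  have hκα : 2 * κ = α * (β + Γ) := by rw [hα, div_mul_cancel₀ _ (by linarith)]
  have hev := eventually_lt_dampedGamma hpr hκ0.le (show κ < Γ by rw [hκ]; linarith)
  -- The two bounds make the damped powers in `x` (damping `η = δ/q`) and the test functions
  -- (damping `δ/q'`) decreasing.
  have hmem : ∀ᶠ η : ℝ in nhdsWithin 0 (Ioi 0), η ∈ Ioo (0 : ℝ) (min p⁻¹ (p⁻¹ * q' / q)) :=
    Ioo_mem_nhdsGT (by positivity)
  obtain ⟨η, hηκ, hη0, hηmin⟩ := (hev.and hmem).exists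
  have hηp : η ≤ p⁻¹ := (hηmin.trans_le (min_le_left _ _)).le
  set δ := η * q with hδdef
  have hδ0 : 0 < δ := mul_pos hη0 hq0
  have hδη : δ / q = η := by rw [hδdef]; field_simp
  have hηp' : δ / q' ≤ p⁻¹ := by
    have h := (hηmin.trans_le (min_le_right _ _)).le
    rw [le_div_iff₀ hq0] at h
    rwa [div_le_iff₀ hq'0]
  obtain ⟨B₁, hB₁⟩ := exists_weightedPow_sum_le p hq hδ0 hα1
  obtain ⟨B₂, hB₂⟩ := exists_weightedPow_sum_le p hq'1 hδ0 hα1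
  set a := sparseFactor (max B₁ B₂) with ha
  have ha0 : ∀ i, 0 < a i := sparseFactor_pos _
  have hbound := hB₁ _ (le_max_left B₁ B₂) a (Or.inl fun _ => rfl)
  have hbound' := hB₂ _ (le_max_right B₁ B₂) (fun i => (a i)⁻¹) (Or.inr fun _ => rfl)
  rw [hδη] at hbound
  set M := α * (2 / δ) with hM
  have hM0 : 0 < M := by positivity
  have hupper : ∀ (S : Finset ℕ) (c : ℕ → ℝ),
      lorentzENorm halfLine p q (fun s => ∑ i ∈ S, c i * dampedPower p η (a i) s) ≤
        ENNReal.ofReal (M * ∑ i ∈ S, |c i| ^ q) ^ (1 / q) := by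
    intro S c
    refine le_rpow_one_div hq0 ?_
    rw [hM, mul_assoc]
    refine (lorentzENorm_rpow_le_weightedPow hp0 hq0 (sum_mul_dampedPower_antitoneOn hη0.le hηp
      ha0 S c) ((measurable_sum_mul_dampedPower p η a S fun i => |c i|).ennreal_ofReal) ?_).trans
      (hbound S c)
    filter_upwards [ae_restrict_mem measurableSet_Ioi] with s hs
    refine ENNReal.ofReal_le_ofReal ((Finset.abs_sum_le_sum_abs _ _).trans_eq ?_)
    exact Finset.sum_congr rfl fun i _ => by
      rw [abs_mul, abs_of_nonneg (dampedPower_nonneg p η (a i) hs)]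
  refine ⟨η, M, a, hM0, sparseFactor_zero _, ha0, fun S c => ⟨hupper S c, ?_⟩⟩
  have hint : ∀ i t, 0 < t →
      Integrable (fun s => dampedPower p η (a i) s * Real.exp (-(t * s))) halfLine := by
    intro i t ht
    refine integrable_laplace hpr.lt hq (measurable_dampedPower p η (a i)).aemeasurable ?_ ht
    have h := hupper {i} fun _ => 1
    simp only [Finset.sum_singleton, one_mul] at h
    exact h.trans_lt (ENNReal.rpow_lt_top_of_nonneg (by positivity) ENNReal.ofReal_ne_top)
  choose d hd1 hd2 hd3 using exists_aligned hq
  set x : ℝ → ℝ := fun s => ∑ i ∈ S, c i * dampedPower p η (a i) s with hx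
  set P : ℝ → ℝ≥0∞ := fun s => ENNReal.ofReal (∑ i ∈ S, |c i| * dampedPower p η (a i) s) with hP
  set Q : ℝ → ℝ≥0∞ := fun t =>
    ENNReal.ofReal (∑ i ∈ S, |d (c i)| * dampedPower p (δ / q') (a i)⁻¹ t) with hQ
  have hxm : Measurable x := measurable_sum_mul_dampedPower p η a S c
  have hPm : Measurable P := (measurable_sum_mul_dampedPower p η a S fun i => |c i|).ennreal_ofReal
  have hQm : Measurable Q := (measurable_sum_mul_dampedPower p (δ / q') (fun i => (a i)⁻¹) S
    fun i => |d (c i)|).ennreal_ofReal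
  have hQa : AntitoneOn Q (Ioi 0) := sum_mul_dampedPower_antitoneOn (by positivity) hηp'
    (fun i => inv_pos.2 (ha0 i)) S _
  set T := ∑ i ∈ S, |c i| ^ q with hT
  have hT0 : 0 ≤ T := Finset.sum_nonneg fun i _ => by positivity
  have hPW : weightedPow p q P ≤ ENNReal.ofReal (M * T) := by
    rw [hM, mul_assoc]; exact hbound S c
  have hQW : weightedPow p q' Q ≤ ENNReal.ofReal (M * T) := by
    rw [hM, mul_assoc]
    have h := hbound' S fun i => d (c i)
    simp only [hq', hd3] at h
    exact h
  set W := ENNReal.ofReal (M * T) with hW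
  have hpoint : ∀ t, 0 < t → ∑ i ∈ S, ENNReal.ofReal (2 * |c i| ^ q) *
      (lintegralLaplace (fun s => ENNReal.ofReal (dampedPower p η (a i) s)) t *
        ENNReal.ofReal (dampedPower p (δ / q') (a i)⁻¹ t)) ≤
      ENNReal.ofReal |laplaceTransform x t| * Q t + lintegralLaplace P t * Q t := by
    intro t ht
    have hLnn : ∀ i, 0 ≤ laplaceTransform (dampedPower p η (a i)) t := fun i =>
      setIntegral_nonneg measurableSet_Ioi fun s hs =>
        mul_nonneg (dampedPower_nonneg p η (a i) hs) (Real.exp_pos _).le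
    have hknn : ∀ i, 0 ≤ dampedPower p (δ / q') (a i)⁻¹ t := fun i => dampedPower_nonneg _ _ _ ht
    have hLP : lintegralLaplace P t =
        ENNReal.ofReal (∑ i ∈ S, |c i| * laplaceTransform (dampedPower p η (a i)) t) := by
      rw [← laplaceTransform_sum (fun i => hint i t ht) S, ofReal_laplaceTransform]
      · intro s hs
        exact Finset.sum_nonneg fun i _ =>
          mul_nonneg (abs_nonneg _) (dampedPower_nonneg p η (a i) hs)
      · simp only [Finset.sum_mul]
        refine integrable_finsetSum _ fun i _ => ?_
        simpa only [mul_assoc] using (hint i t ht).const_mul |c i|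
    have hterm : ∀ i, ENNReal.ofReal (2 * |c i| ^ q) *
        (lintegralLaplace (fun s => ENNReal.ofReal (dampedPower p η (a i) s)) t *
          ENNReal.ofReal (dampedPower p (δ / q') (a i)⁻¹ t)) =
        ENNReal.ofReal (2 * (|c i| * |d (c i)| * (laplaceTransform (dampedPower p η (a i)) t *
          dampedPower p (δ / q') (a i)⁻¹ t))) := by
      intro i
      rw [← ofReal_laplaceTransform (fun s hs => dampedPower_nonneg p η (a i) hs) (hint i t ht),
        ← ENNReal.ofReal_mul (hLnn i), ← ENNReal.ofReal_mul (by positivity), hd2, mul_assoc]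
    simp_rw [hterm]
    rw [hLP, ← ENNReal.ofReal_sum_of_nonneg, ← Finset.mul_sum, hx,
      laplaceTransform_sum (fun i => hint i t ht) S c, hQ, ← ENNReal.ofReal_mul (abs_nonneg _),
      ← ENNReal.ofReal_mul, ← ENNReal.ofReal_add]
    · exact ENNReal.ofReal_le_ofReal
        (two_mul_sum_le_of_aligned S (fun i => hd1 (c i)) hLnn hknn)
    · exact mul_nonneg (abs_nonneg _)
        (Finset.sum_nonneg fun i _ => mul_nonneg (abs_nonneg _) (hknn i))
    · exact mul_nonneg (Finset.sum_nonneg fun i _ => mul_nonneg (abs_nonneg _) (hLnn i))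
        (Finset.sum_nonneg fun i _ => mul_nonneg (abs_nonneg _) (hknn i))
    · exact Finset.sum_nonneg fun i _ => mul_nonneg (abs_nonneg _) (hLnn i)
    · intro i _
      have := hLnn i
      have := hknn i
      positivity
  have hLm : ∀ i, Measurable
      (lintegralLaplace fun s => ENNReal.ofReal (dampedPower p η (a i) s)) := fun i =>
    measurable_lintegralLaplace (measurable_dampedPower p η (a i)).ennreal_ofReal
  have hkm : ∀ i, Measurable fun t => ENNReal.ofReal (dampedPower p (δ / q') (a i)⁻¹ t) :=
    fun i => (measurable_dampedPower p (δ / q') (a i)⁻¹).ennreal_ofReal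
  have hWsplit : W = W ^ (1 / q) * W ^ (1 / q') := by
    rw [← ENNReal.rpow_add_of_nonneg _ _ (by positivity) (by positivity), one_div, one_div,
      hqq.inv_add_inv_eq_one, ENNReal.rpow_one]
  -- The left side is a lower bound for twice the diagonal. The right side bounds the pairing of
  -- `|Lx|` with `Q` by duality, and that of `L P` with `Q` by the upper norm estimate.
  have hlow : ENNReal.ofReal (2 * κ * (2 / δ * T)) ≤
      lorentzENorm halfLine r q (laplaceTransform x) * W ^ (1 / q') + ENNReal.ofReal Γ * W := by
    calc ENNReal.ofReal (2 * κ * (2 / δ * T))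
        = ∑ i ∈ S, ENNReal.ofReal (2 * |c i| ^ q) * (ENNReal.ofReal κ * ENNReal.ofReal (2 / δ)) := by
          rw [← Finset.sum_mul, ← ENNReal.ofReal_sum_of_nonneg (fun i _ => by positivity),
            ← ENNReal.ofReal_mul hκ0.le, ← ENNReal.ofReal_mul
            (Finset.sum_nonneg fun i _ => by positivity), ← Finset.mul_sum]
          congr 1
          ring
      _ ≤ ∑ i ∈ S, ∫⁻ t in Ioi (0 : ℝ), ENNReal.ofReal (2 * |c i| ^ q) *
          (lintegralLaplace (fun s => ENNReal.ofReal (dampedPower p η (a i) s)) t *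
            ENNReal.ofReal (dampedPower p (δ / q') (a i)⁻¹ t)) := by
          refine Finset.sum_le_sum fun i _ => ?_
          rw [lintegral_const_mul' _ _ ENNReal.ofReal_ne_top]
          refine mul_le_mul_right ((mul_le_mul_left hηκ.le _).trans ?_) _
          have h := dampedGamma_mul_le_lintegral hpr hqq hδ0 (ha0 i)
          rwa [hδη] at h
      _ = ∫⁻ t in Ioi (0 : ℝ), ∑ i ∈ S, ENNReal.ofReal (2 * |c i| ^ q) *
          (lintegralLaplace (fun s => ENNReal.ofReal (dampedPower p η (a i) s)) t *
            ENNReal.ofReal (dampedPower p (δ / q') (a i)⁻¹ t)) :=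
          (lintegral_finsetSum _ fun i _ => ((hLm i).mul (hkm i)).const_mul _).symm
      _ ≤ ∫⁻ t in Ioi (0 : ℝ), (ENNReal.ofReal |laplaceTransform x t| * Q t +
            lintegralLaplace P t * Q t) := setLIntegral_mono' measurableSet_Ioi hpoint
      _ = (∫⁻ t in Ioi (0 : ℝ), ENNReal.ofReal |laplaceTransform x t| * Q t) +
            ∫⁻ t in Ioi (0 : ℝ), lintegralLaplace P t * Q t :=
          lintegral_add_right _ ((measurable_lintegralLaplace hPm).mul hQm)
      _ ≤ _ := by
          refine add_le_add ?_ ?_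
          · refine (lintegral_abs_mul_le_lorentzENorm hpr.symm hqq
              (measurable_laplaceTransform hxm).aemeasurable hQa hQm).trans ?_
            gcongr
          · refine (lintegral_mul_le_weightedPow hpr.symm hqq
              (measurable_lintegralLaplace hPm) hQm).trans ?_
            calc _ ≤ (ENNReal.ofReal Γ ^ q * W) ^ (1 / q) * W ^ (1 / q') := by
                  gcongr
                  exact (weightedPow_lintegralLaplace_le hpr hq hPm).trans
                    (mul_le_mul_right hPW _)
              _ = ENNReal.ofReal Γ * W := by
                  rw [ENNReal.mul_rpow_of_nonneg _ _ (by positivity), ← ENNReal.rpow_mul,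
                    mul_one_div, div_self hq0.ne', ENNReal.rpow_one, mul_assoc, ← hWsplit]
  have hβW : ENNReal.ofReal β * W ≤
      lorentzENorm halfLine r q (laplaceTransform x) * W ^ (1 / q') := by
    have hΓ0 : 0 < Γ := hβ0.trans hβ
    -- By the choice of `α` and `M`, the left side of `hlow` is exactly `(β + Γ) * W`, so
    -- subtracting `Γ * W` leaves `β * W`.
    have e : ENNReal.ofReal (2 * κ * (2 / δ * T)) = ENNReal.ofReal β * W + ENNReal.ofReal Γ * W := by
      rw [← add_mul, ← ENNReal.ofReal_add hβ0.le hΓ0.le, hW, ← ENNReal.ofReal_mul (by positivity),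
        hκα, hM]
      congr 1
      ring
    rw [e] at hlow
    exact (ENNReal.add_le_add_iff_right (ENNReal.mul_ne_top ENNReal.ofReal_ne_top
      ENNReal.ofReal_ne_top)).1 hlow
  rcases eq_or_ne W 0 with hW0 | hW0
  · rw [hW0, ENNReal.zero_rpow_of_pos (by positivity), mul_zero]
    exact zero_le
  · have hWT : W ≠ ∞ := ENNReal.ofReal_ne_top
    nth_rewrite 1 [hWsplit] at hβW
    rw [← mul_assoc] at hβW
    exact (ENNReal.mul_le_mul_iff_left (by simp [ENNReal.rpow_eq_zero_iff, hW0, hWT])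
      (ENNReal.rpow_ne_top_of_nonneg (by positivity) hWT)).1 hβW

/-! ### The Lorentz quasi-norm -/

theorem lorentzENorm_zero {p q : ℝ} (hp : 0 < p) (hq : 0 < q) :
    lorentzENorm halfLine p q 0 = 0 := by
  have h := lorentzENorm_rpow_le_weightedPow (f := 0) (φ := 0) hp hq
    (fun _ _ _ _ _ => le_rfl) measurable_zero (by simp)
  have h0 : weightedPow p q 0 = 0 := by simp [weightedPow, ENNReal.zero_rpow_of_pos hq]
  rw [h0, nonpos_iff_eq_zero, ENNReal.rpow_eq_zero_iff_of_pos hq] at h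
  exact h

theorem ae_eq_zero_of_lorentzENorm_eq_zero {p q : ℝ} (hp : 1 < p) (hq : 1 < q) {f : ℝ → ℝ}
    (hf : AEMeasurable f halfLine) (h : lorentzENorm halfLine p q f = 0) : f =ᵐ[halfLine] 0 := by
  -- The constant `1` has infinite dual norm, but the convention `0 * ∞ = 0` makes the bound vanish.
  have h1 := lintegral_abs_mul_le_lorentzENorm (Real.HolderConjugate.conjExponent hp)
    (Real.HolderConjugate.conjExponent hq) hf (Q := fun _ => 1) (fun _ _ _ _ _ => le_rfl)
    measurable_const
  rw [h, zero_mul, nonpos_iff_eq_zero, lintegral_eq_zero_iff' (by fun_prop)] at h1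
  filter_upwards [h1] with x hx
  simpa using hx

theorem lorentzENorm_smul {p q c : ℝ} (hq : 0 < q) (hc : 0 < c) (f : ℝ → ℝ) :
    lorentzENorm halfLine p q (c • f) = ENNReal.ofReal c * lorentzENorm halfLine p q f := by
  have hD : ∀ t, distribution (c • f) t = distribution f (c⁻¹ * t) := by
    intro t
    rw [distribution, distribution]
    congr 1
    ext x
    simp only [Pi.smul_apply, smul_eq_mul, abs_mul, abs_of_pos hc, mem_ofPred_eq]
    rw [inv_mul_lt_iff₀ hc]
  have hcq : ENNReal.ofReal c ^ q = ENNReal.ofReal (c ^ (q - 1)) * ENNReal.ofReal c := by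
    rw [ENNReal.ofReal_rpow_of_pos hc, ← ENNReal.ofReal_mul (by positivity),
      Real.rpow_sub_one hc.ne', div_mul_cancel₀ _ hc.ne']
  refine ENNReal.rpow_left_injective hq.ne' ?_
  beta_reduce
  rw [ENNReal.mul_rpow_of_nonneg _ _ hq.le, lorentzENorm_rpow hq,
    lorentzENorm_rpow hq, mul_left_comm]
  congr 1
  have e : ∀ t ∈ Ioi (0 : ℝ), ENNReal.ofReal (t ^ (q - 1)) * distribution (c • f) t ^ (q / p) =
      ENNReal.ofReal (c ^ (q - 1)) * (ENNReal.ofReal ((c⁻¹ * t) ^ (q - 1)) *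
        distribution f (c⁻¹ * t) ^ (q / p)) := by
    intro t ht
    have ht0 : (0 : ℝ) < t := ht
    rw [hD, ← mul_assoc, ← ENNReal.ofReal_mul (by positivity),
      ← Real.mul_rpow hc.le (by positivity), mul_inv_cancel_left₀ hc.ne']
  rw [setLIntegral_congr_fun measurableSet_Ioi e, lintegral_const_mul' _ _ ENNReal.ofReal_ne_top,
    lintegral_Ioi_comp_mul_left (fun u => ENNReal.ofReal (u ^ (q - 1)) *
      distribution f u ^ (q / p)) (inv_pos.2 hc), inv_inv, hcq, mul_assoc]

theorem ae_halfLine_comp_mul_left {P : ℝ → Prop} (h : ∀ᵐ x ∂halfLine, P x) {c : ℝ} (hc : 0 < c) :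
    ∀ᵐ x ∂halfLine, P (c * x) := by
  set N := toMeasurable halfLine {x | ¬ P x} with hN
  have hNm : MeasurableSet N := measurableSet_toMeasurable _ _
  have hN0 : halfLine N = 0 := by rw [hN, measure_toMeasurable]; exact h
  refine measure_mono_null (t := (fun x => c * x) ⁻¹' N)
    (fun x hx => subset_toMeasurable halfLine {x | ¬ P x} hx) ?_
  rw [← lintegral_indicator_one (hNm.preimage (measurable_const_mul c))]
  have h1 := lintegral_Ioi_comp_mul_left (N.indicator 1) hc
  rw [lintegral_indicator_one hNm, hN0, mul_zero] at h1
  exact h1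

theorem lorentzSpace.enorm_eq {p q : ℝ} {hp : 0 < p} {hq : 0 < q}
    (x : lorentzSpace halfLine p q hp hq) :
    ‖x‖ₑ = lorentzENorm halfLine p q (x : ℝ →ₘ[halfLine] ℝ) := rfl

theorem lorentzSpace.exists_smul_enorm_eq_one {p q : ℝ} (hp : 1 < p) (hq : 1 < q)
    {x : lorentzSpace halfLine p q (exponent_pos hp) (exponent_pos hq)} (hx : x ≠ 0) :
    ∃ c : ℝ, ‖c • x‖ₑ = 1 := by
  have h0 : ‖x‖ₑ ≠ 0 := by
    intro h
    refine hx (Subtype.ext (AEEqFun.ext ?_))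
    have h1 := ae_eq_zero_of_lorentzENorm_eq_zero hp hq
      (x : ℝ →ₘ[halfLine] ℝ).measurable.aemeasurable h
    exact h1.trans AEEqFun.coeFn_zero.symm
  have hT : ‖x‖ₑ ≠ ∞ := ne_of_lt x.2
  have hpos := ENNReal.toReal_pos h0 hT
  refine ⟨‖x‖ₑ.toReal⁻¹, ?_⟩
  rw [lorentzSpace.enorm_eq, Submodule.coe_smul, lorentzENorm_congr (AEEqFun.coeFn_smul _ _),
    lorentzENorm_smul (exponent_pos hq) (inv_pos.2 hpos),
    ← lorentzSpace.enorm_eq, ENNReal.ofReal_inv_of_pos hpos, ENNReal.ofReal_toReal hT,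
    ENNReal.inv_mul_cancel h0 hT]

theorem lorentzSpace.coeFn_sum_smul {p q : ℝ} {hp : 0 < p} {hq : 0 < q}
    {g : ℕ → lorentzSpace halfLine p q hp hq} {F : ℕ → ℝ → ℝ}
    (hg : ∀ i, ((g i : ℝ →ₘ[halfLine] ℝ) : ℝ → ℝ) =ᵐ[halfLine] F i) (S : Finset ℕ) (c : ℕ → ℝ) :
    (((∑ i ∈ S, c i • g i : lorentzSpace halfLine p q hp hq) : ℝ →ₘ[halfLine] ℝ) : ℝ → ℝ)
      =ᵐ[halfLine] fun s => ∑ i ∈ S, c i * F i s := by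
  induction S using Finset.induction_on with
  | empty =>
    simp only [Finset.sum_empty]
    exact AEEqFun.coeFn_zero
  | insert i S hi ih =>
    rw [Finset.sum_insert hi, Submodule.coe_add, Submodule.coe_smul]
    filter_upwards [AEEqFun.coeFn_add (c i • (g i : ℝ →ₘ[halfLine] ℝ))
      ((∑ i ∈ S, c i • g i : lorentzSpace halfLine p q hp hq) : ℝ →ₘ[halfLine] ℝ),
      AEEqFun.coeFn_smul (c i) (g i : ℝ →ₘ[halfLine] ℝ), ih, hg i] with s h1 h2 h3 h4
    rw [h1, Pi.add_apply, h2, Pi.smul_apply, h3, h4, Finset.sum_insert hi, smul_eq_mul]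

/-! ### The Laplace transform as an operator between Lorentz spaces -/

theorem laplaceTransform_congr {f g : ℝ → ℝ} (h : f =ᵐ[halfLine] g) :
    laplaceTransform f = laplaceTransform g := by
  ext t
  refine integral_congr_ae ?_
  filter_upwards [h] with s hs
  rw [hs]

theorem holderConjugate_div {p : ℝ} (hp : 1 < p) : p.HolderConjugate (p / (p - 1)) :=
  Real.HolderConjugate.conjExponent hp

theorem lorentzSpace.integrable_mul_exp {p q : ℝ} (hp : 1 < p) (hq : 1 < q)
    (f : lorentzSpace halfLine p q (exponent_pos hp) (exponent_pos hq)) {t : ℝ} (ht : 0 < t) :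
    Integrable (fun s => (f : ℝ →ₘ[halfLine] ℝ) s * Real.exp (-(t * s))) halfLine :=
  integrable_laplace hp hq (f : ℝ →ₘ[halfLine] ℝ).measurable.aemeasurable f.2 ht

/-- The Laplace transform from `L^{p,q}(0, ∞)` to `L^{p',q}(0, ∞)`. -/
noncomputable def laplaceOperator {p q : ℝ} (hp : 1 < p) (hq : 1 < q) :
    lorentzSpace halfLine p q (exponent_pos hp) (exponent_pos hq) →ₗ[ℝ]
      lorentzSpace halfLine (p / (p - 1)) q (conjExponent_pos hp) (exponent_pos hq) where
  toFun f := ⟨AEEqFun.mk (laplaceTransform (f : ℝ →ₘ[halfLine] ℝ))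
    (measurable_laplaceTransform (f : ℝ →ₘ[halfLine] ℝ).measurable).aestronglyMeasurable, by
      change lorentzENorm halfLine _ _ _ < ∞
      rw [lorentzENorm_congr (AEEqFun.coeFn_mk _ _)]
      exact (lorentzENorm_laplaceTransform_le (holderConjugate_div hp) hq
        (f : ℝ →ₘ[halfLine] ℝ).measurable.aemeasurable).trans_lt
        (ENNReal.mul_lt_top ENNReal.ofReal_lt_top f.2)⟩
  map_add' f g := by
    refine Subtype.ext ?_
    change AEEqFun.mk _ _ = AEEqFun.mk _ _ + AEEqFun.mk _ _
    rw [AEEqFun.mk_add_mk, AEEqFun.mk_eq_mk, Submodule.coe_add,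
      laplaceTransform_congr (AEEqFun.coeFn_add _ _)]
    filter_upwards [ae_restrict_mem measurableSet_Ioi] with t ht
    simp only [laplaceTransform, Pi.add_apply, add_mul]
    exact integral_add (lorentzSpace.integrable_mul_exp hp hq f ht)
      (lorentzSpace.integrable_mul_exp hp hq g ht)
  map_smul' c f := by
    refine Subtype.ext ?_
    change AEEqFun.mk _ _ = c • AEEqFun.mk _ _
    rw [AEEqFun.smul_mk, AEEqFun.mk_eq_mk, Submodule.coe_smul,
      laplaceTransform_congr (AEEqFun.coeFn_smul _ _)]
    filter_upwards with t
    simp only [laplaceTransform, Pi.smul_apply, smul_eq_mul, mul_assoc]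
    exact integral_const_mul _ _

theorem coeFn_laplaceOperator {p q : ℝ} (hp : 1 < p) (hq : 1 < q)
    (f : lorentzSpace halfLine p q (exponent_pos hp) (exponent_pos hq)) :
    ((laplaceOperator hp hq f : ℝ →ₘ[halfLine] ℝ) : ℝ → ℝ) =ᵐ[halfLine]
      laplaceTransform (f : ℝ →ₘ[halfLine] ℝ) :=
  AEEqFun.coeFn_mk _ _

theorem enorm_laplaceOperator {p q : ℝ} (hp : 1 < p) (hq : 1 < q)
    (f : lorentzSpace halfLine p q (exponent_pos hp) (exponent_pos hq)) :
    ‖laplaceOperator hp hq f‖ₑ =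
      lorentzENorm halfLine (p / (p - 1)) q (laplaceTransform (f : ℝ →ₘ[halfLine] ℝ)) := by
  rw [lorentzSpace.enorm_eq, lorentzENorm_congr (coeFn_laplaceOperator hp hq f)]

theorem enorm_laplaceOperator_le {p q : ℝ} (hp : 1 < p) (hq : 1 < q)
    (f : lorentzSpace halfLine p q (exponent_pos hp) (exponent_pos hq)) :
    ‖laplaceOperator hp hq f‖ₑ ≤ ENNReal.ofReal (Real.Gamma (p / (p - 1))⁻¹) * ‖f‖ₑ := by
  rw [enorm_laplaceOperator]
  exact lorentzENorm_laplaceTransform_le (holderConjugate_div hp) hq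
    (f : ℝ →ₘ[halfLine] ℝ).measurable.aemeasurable

theorem opENorm_laplaceOperator_le {p q : ℝ} (hp : 1 < p) (hq : 1 < q) :
    opENorm (laplaceOperator hp hq) ≤ ENNReal.ofReal (Real.Gamma (p / (p - 1))⁻¹) :=
  iSup₂_le fun f hf => (enorm_laplaceOperator_le hp hq f).trans (mul_le_of_le_one_right' hf)

/-- For each `β` below the norm of the Laplace transform, some sequence of dilates spans a
subspace on which the transform is bounded below by `β`. -/
theorem exists_dilates_laplaceOperator {p q β : ℝ} (hp : 1 < p) (hq : 1 < q) (hβ0 : 0 < β)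
    (hβ : β < Real.Gamma (p / (p - 1))⁻¹) :
    ∃ (f : lorentzSpace halfLine p q (exponent_pos hp) (exponent_pos hq)) (a : ℕ → ℝ)
      (g : ℕ → lorentzSpace halfLine p q (exponent_pos hp) (exponent_pos hq)),
      (∀ i, 0 < a i) ∧
      (∀ i, ((g i : ℝ →ₘ[halfLine] ℝ) : ℝ → ℝ) =ᵐ[halfLine]
        fun t => a i ^ (1 / p) * (f : ℝ →ₘ[halfLine] ℝ) (a i * t)) ∧
      LinearIndependent ℝ g ∧
      ∀ x ∈ Submodule.span ℝ (range g), ENNReal.ofReal β * ‖x‖ₑ ≤ ‖laplaceOperator hp hq x‖ₑ := by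
  have hp0 := exponent_pos hp
  have hq0 := exponent_pos hq
  obtain ⟨η, M, a, hM, ha1, ha0, hbd⟩ :=
    exists_sparse_dampedPower (holderConjugate_div hp) hq hβ0 hβ
  have hmem : ∀ i, lorentzENorm halfLine p q (dampedPower p η (a i)) < ∞ := by
    intro i
    have h := (hbd {i} fun _ => 1).1
    simp only [Finset.sum_singleton, one_mul] at h
    exact h.trans_lt (ENNReal.rpow_lt_top_of_nonneg (by positivity) ENNReal.ofReal_ne_top)
  let g : ℕ → lorentzSpace halfLine p q hp0 hq0 := fun i =>
    ⟨AEEqFun.mk (dampedPower p η (a i)) (measurable_dampedPower p η (a i)).aestronglyMeasurable, by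
      change lorentzENorm halfLine _ _ _ < ∞
      rw [lorentzENorm_congr (AEEqFun.coeFn_mk _ _)]
      exact hmem i⟩
  have hg : ∀ i, ((g i : ℝ →ₘ[halfLine] ℝ) : ℝ → ℝ) =ᵐ[halfLine] dampedPower p η (a i) :=
    fun i => AEEqFun.coeFn_mk _ _
  have hsum : ∀ (S : Finset ℕ) (c : ℕ → ℝ), ‖∑ i ∈ S, c i • g i‖ₑ ≤
        ENNReal.ofReal (M * ∑ i ∈ S, |c i| ^ q) ^ (1 / q) ∧
      ENNReal.ofReal β * ENNReal.ofReal (M * ∑ i ∈ S, |c i| ^ q) ^ (1 / q) ≤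
        ‖laplaceOperator hp hq (∑ i ∈ S, c i • g i)‖ₑ := by
    intro S c
    have h := lorentzSpace.coeFn_sum_smul hg S c
    rw [enorm_laplaceOperator, laplaceTransform_congr h, lorentzSpace.enorm_eq,
      lorentzENorm_congr h]
    exact hbd S c
  -- Since `a 0 = 1`, the generating function is `g 0`; the factor `a i ^ (1 / p)` cancels the
  -- dilation of `s^(-1/p)`.
  refine ⟨g 0, a, g, ha0, fun i => ?_, ?_, ?_⟩
  · filter_upwards [hg i, ae_halfLine_comp_mul_left (hg 0) (ha0 i),
      ae_restrict_mem measurableSet_Ioi] with t h1 h2 ht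
    have ht0 : (0 : ℝ) < t := ht
    rw [h1, h2, ha1, dampedPower, dampedPower, one_mul, Real.mul_rpow (ha0 i).le ht0.le,
      ← mul_assoc, ← mul_assoc, ← Real.rpow_add (ha0 i), one_div, add_neg_cancel, Real.rpow_zero,
      one_mul]
  -- The lower bound already gives independence: if a combination is zero, so is its transform,
  -- which forces the sum of the `|c i| ^ q` to vanish.
  · refine linearIndependent_iff'.2 fun S c hc i hi => ?_
    have h := (hsum S c).2
    rw [hc, map_zero, lorentzSpace.enorm_eq, Submodule.coe_zero,
      lorentzENorm_congr AEEqFun.coeFn_zero, lorentzENorm_zero (conjExponent_pos hp) hq0,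
      nonpos_iff_eq_zero, mul_eq_zero, ENNReal.rpow_eq_zero_iff_of_pos (by positivity)] at h
    have h1 : M * ∑ i ∈ S, |c i| ^ q ≤ 0 := by
      rcases h with h | h
      · exact absurd (ENNReal.ofReal_eq_zero.1 h) (not_le.2 hβ0)
      · exact ENNReal.ofReal_eq_zero.1 h
    have h2 : |c i| ^ q ≤ 0 := (Finset.single_le_sum (f := fun i => |c i| ^ q)
      (fun j _ => by positivity) hi).trans (nonpos_of_mul_nonpos_right h1 hM)
    by_contra hci
    exact absurd h2 (not_le.2 (Real.rpow_pos_of_pos (abs_pos.2 hci) q))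
  · intro x hx
    obtain ⟨c, rfl⟩ := (Finsupp.mem_span_range_iff_exists_finsupp).1 hx
    exact (mul_le_mul_right (hsum c.support c).1 _).trans (hsum c.support c).2

/-! ### Bernstein numbers and the main theorem -/

theorem bernsteinNumber_le_opENorm {p q : ℝ} (hp : 1 < p) (hq : 1 < q) {Y : Type*}
    [AddCommGroup Y] [Module ℝ Y] [ENorm Y]
    (T : lorentzSpace halfLine p q (exponent_pos hp) (exponent_pos hq) →ₗ[ℝ] Y) {n : ℕ}
    (hn : 1 ≤ n) : bernsteinNumber n T ≤ opENorm T := by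
  refine iSup₂_le fun Z hZ => ?_
  -- For `Z = ⊥` the infimum would be over an empty set and equal to `∞`; `1 ≤ n` excludes this.
  have hne : Z ≠ ⊥ := by
    rintro rfl
    rw [rank_bot] at hZ
    have : n = 0 := by exact_mod_cast hZ.symm
    omega
  obtain ⟨x, hxZ, hx0⟩ := Z.ne_bot_iff.1 hne
  obtain ⟨c, hc⟩ := lorentzSpace.exists_smul_enorm_eq_one hp hq hx0
  exact (iInf₂_le (c • x) ⟨Z.smul_mem c hxZ, hc⟩).trans
    (le_iSup₂ (f := fun (x : lorentzSpace halfLine p q (exponent_pos hp) (exponent_pos hq))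
      (_ : ‖x‖ₑ ≤ 1) => ‖T x‖ₑ) (c • x) hc.le)

/-- For each `β` below the Gamma value, the first `n` sparse dilates span a competitor with lower
bound `β`. With the two upper bounds this closes the chain `b_n ≤ ‖L‖ ≤ Γ(1/r) ≤ b_n`. -/
theorem le_bernsteinNumber_laplaceOperator {p q : ℝ} (hp : 1 < p) (hq : 1 < q) (n : ℕ) :
    ENNReal.ofReal (Real.Gamma (p / (p - 1))⁻¹) ≤ bernsteinNumber n (laplaceOperator hp hq) := by
  refine le_of_forall_lt fun b hb => ?_
  have hbT : b ≠ ∞ := hb.ne_top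
  obtain ⟨β, hβ1, hβ2⟩ := exists_between ((ENNReal.lt_ofReal_iff_toReal_lt hbT).1 hb)
  have hβ0 : 0 < β := ENNReal.toReal_nonneg.trans_lt hβ1
  obtain ⟨-, -, g, -, -, hli, hlow⟩ := exists_dilates_laplaceOperator hp hq hβ0 hβ2
  have hli' : LinearIndependent ℝ fun i : Fin n => g i := hli.comp _ Fin.val_injective
  have hrank : Module.rank ℝ (Submodule.span ℝ (range fun i : Fin n => g i)) = n := by
    rw [rank_span hli', Cardinal.mk_range_eq _ hli'.injective, Cardinal.mk_fin]
  refine ((ENNReal.lt_ofReal_iff_toReal_lt hbT).2 hβ1).trans_le ?_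
  refine le_trans (le_iInf₂ fun x hx => ?_) (le_iSup₂ (f := fun (Z : Submodule ℝ
    (lorentzSpace halfLine p q (exponent_pos hp) (exponent_pos hq))) (_ : Module.rank ℝ Z = n) =>
    ⨅ (x) (_ : x ∈ Z ∧ ‖x‖ₑ = 1), ‖laplaceOperator hp hq x‖ₑ) _ hrank)
  have hmem := Submodule.span_mono (R := ℝ)
    (range_subset_iff.2 fun i : Fin n => mem_range_self (f := g) (i : ℕ)) hx.1
  simpa [hx.2] using hlow x hmem

theorem mainTheorem8 (p q : ℝ) (hp : 1 < p) (hq : 1 < q) :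
    ∃ L : lorentzSpace halfLine p q (exponent_pos hp) (exponent_pos hq) →ₗ[ℝ]
        lorentzSpace halfLine (p / (p - 1)) q (conjExponent_pos hp) (exponent_pos hq),
      -- `L` is the Laplace transform, given by absolutely convergent integrals
      (∀ f : lorentzSpace halfLine p q (exponent_pos hp) (exponent_pos hq), (∀ t : ℝ, 0 < t →
          Integrable (fun s => (f : ℝ →ₘ[halfLine] ℝ) s * Real.exp (-(t * s))) halfLine) ∧
        ((L f : ℝ →ₘ[halfLine] ℝ) : ℝ → ℝ) =ᵐ[halfLine]
          laplaceTransform (f : ℝ →ₘ[halfLine] ℝ)) ∧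
      -- `L` is bounded
      opENorm L < ∞ ∧
      -- `L` is not strictly singular
      ¬ IsStrictlySingular L ∧
      -- `L` is an isomorphism on an infinite-dimensional span of dilates of one function
      (∃ (f : lorentzSpace halfLine p q (exponent_pos hp) (exponent_pos hq)) (a : ℕ → ℝ)
        (g : ℕ → lorentzSpace halfLine p q (exponent_pos hp) (exponent_pos hq)),
        (∀ i, 0 < a i) ∧
        (∀ i, ((g i : ℝ →ₘ[halfLine] ℝ) : ℝ → ℝ) =ᵐ[halfLine]
          fun t => a i ^ (1 / p) * (f : ℝ →ₘ[halfLine] ℝ) (a i * t)) ∧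
        ¬ FiniteDimensional ℝ (Submodule.span ℝ (range g)) ∧
        IsIsomorphismOn L (Submodule.span ℝ (range g))) ∧
      -- all Bernstein numbers are equal to the norm
      ∀ n : ℕ, 1 ≤ n → bernsteinNumber n L = opENorm L := by
  have hΓ : 0 < Real.Gamma (p / (p - 1))⁻¹ :=
    Real.Gamma_pos_of_pos (inv_pos.2 (conjExponent_pos hp))
  obtain ⟨f, a, g, ha, hg, hli, hlow⟩ :=
    exists_dilates_laplaceOperator hp hq (half_pos hΓ) (half_lt_self hΓ)
  have hinf : ¬ FiniteDimensional ℝ (Submodule.span ℝ (range g)) := by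
    intro hfin
    have := (linearIndependent_span hli).finite
    exact not_finite ℕ
  have hiso : IsIsomorphismOn (laplaceOperator hp hq) (Submodule.span ℝ (range g)) :=
    ⟨Real.toNNReal (Real.Gamma (p / (p - 1))⁻¹ / 2), Real.toNNReal (Real.Gamma (p / (p - 1))⁻¹),
      Real.toNNReal_pos.2 (half_pos hΓ),
      fun x hx => ⟨hlow x hx, enorm_laplaceOperator_le hp hq x⟩⟩
  refine ⟨laplaceOperator hp hq, fun f => ⟨fun t ht => lorentzSpace.integrable_mul_exp hp hq f ht,
    coeFn_laplaceOperator hp hq f⟩, (opENorm_laplaceOperator_le hp hq).trans_lt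
    ENNReal.ofReal_lt_top, not_not.2 ⟨_, hinf, hiso⟩, ⟨f, a, g, ha, hg, hinf, hiso⟩,
    fun n hn => le_antisymm (bernsteinNumber_le_opENorm hp hq _ hn)
      ((opENorm_laplaceOperator_le hp hq).trans (le_bernsteinNumber_laplaceOperator hp hq n))⟩
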